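/- **Conventions.** A *coloured category* is a category $C$ with a subcategory $W$ containing all objects, whose arrows are called coloured; $\mathbf{CCat}$ is the category of coloured categories and colour-preserving functors. A colour-preserving functor $\varphi:(C,W)\to(C',W')$ is an *equifunctor* if it induces an equivalence of Dwyer–Kan simplicial localisations, i.e. if $\pi_0L\varphi:\pi_0LC\to\pi_0LC'$ is an equivalence of categories and $LC(x,y)\to LC'(\varphi x,\varphi y)$ is a weak equivalence of simplicial sets for all objects $x,y$ of $C$ ($L$ is taken in the form of the hammock localisation). The *fat delta* $\underline\Delta$ has as objects the finite non-empty coloured semi-ordinals, i.e. finite strings of arrows some of which are coloured (an arrow $a<b$ between vertices is coloured when all elementary arrows between $a$ and $b$ are), and as arrows the strictly increasing maps on vertices that preserve coloured arrows. Contracting the coloured arrows defines a functor $\pi:\underline\Delta\to\Delta$; an arrow is *vertical* if $\pi$ sends it to an identity. A *fair monoid in $\mathbf{CCat}$* is a functor $X:\underline\Delta^{\mathrm{op}}\to\mathbf{CCat}$ such that (1) the value of $X$ at the single dot is the discrete category with one object; (2) $X$ sends each pushout in $\underline\Delta$ of $K\leftarrow\bullet\to L$, where the dot $\bullet$ is the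 last vertex of $K$ and the first vertex of $L$, to a pullback; (3) $X$ sends vertical arrows to equifunctors. Write $A$ and $U$ for the values of $X$ at one uncoloured arrow, respectively at one coloured arrow; the composition laws of $A$ and $U$ and the functor $U\to A$ are given by the functoriality of $X$. The objects of $U$ are the *weak units*. **Lemma.** Let $(M,\otimes,I)$ be a monoidal model category in the sense of Hovey: a model category with functorial factorisations and a monoidal category, closed on both sides, that satisfies the pushout-product axiom and the unit axiom (for every weak equivalence $Z\to I$ with $Z$ cofibrant and every cofibrant $X$, the composites $Z\otimes X\to I\otimes X\cong X$ and $X\otimes Z\to X\otimes I\cong X$ are weak equivalences). The unit $I$ need not be cofibrant. Let $M^c$ be the full subcategory of cofibrant objects, coloured by the weak equivalences, and let $U_M$ be the category whose objects are the weak equivalences $Z\to I$ with $Z$ cofibrant and whose arrows are the triangles over $I$, all of them coloured. Then there is a fair monoid $X$ in $\mathbf{CCat}$ such that * there is an equivalence of categories $F:A\to M^c$, under which the coloured arrows of $A$ are exactly those sent to weak equivalences, together with a natural isomorphism, compatible with the associativity constraint of $M$, between the composition law of $A$ and $\otimes$; * there is a natural weak equivalence from the composite $U\to A\to M^c\subset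 M$ to the constant functor $I$ such that the induced functor $U\to U_M$ is an equivalence of categories, all arrows of $U$ are coloured, and the composition law of $U$ corresponds to $(Z\to I,\ Z'\to I)\mapsto(Z\otimes Z'\to I\otimes I\cong I)$. Thus $M^c$ is a fair monoidal coloured category whose weak units are the weak equivalences $Z\to I$ with $Z$ cofibrant. If $\otimes$ is strictly associative, then $X$ can be chosen so that $A\to M^c$ and $U\to U_M$ are isomorphisms of categories and the composition law of $A$ is equal to $\otimes$. -/

import Mathlib

open CategoryTheory Category Limits MonoidalCategory HomotopicalAlgebra Opposite

universe v u

noncomputable section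

/-! ## Coloured categories -/

/-- A coloured category: a category with a specified subcategory comprising all the objects,
whose arrows are called the coloured arrows, or equiarrows. -/
structure CCat where
  /-- the objects -/
  carrier : Type u
  [category : Category.{v} carrier]
  /-- the coloured arrows -/
  equi : MorphismProperty carrier
  [isMultiplicative : equi.IsMultiplicative]

namespace CCat

instance : CoeSort CCat.{v, u} (Type u) := ⟨CCat.carrier⟩

attribute [instance] CCat.category CCat.isMultiplicative

/-- The category of coloured categories and colour-preserving functors. -/
instance : Category CCat.{v, u} where
  Hom C D := LocalizerMorphism C.equi D.equi
  id C := LocalizerMorphism.id C.equi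
  comp F G := LocalizerMorphism.comp F G

/-- The functor underlying a morphism of coloured categories. -/
abbrev functor {C D : CCat.{v, u}} (φ : C ⟶ D) : C ⥤ D := LocalizerMorphism.functor φ

lemma functor_map_equi {C D : CCat.{v, u}} (φ : C ⟶ D) {x y : C} {f : x ⟶ y} (hf : C.equi f) :
    D.equi ((functor φ).map f) :=
  LocalizerMorphism.map φ f hf

/-- The discrete objects: the coloured categories all of whose arrows are identities. -/
def discrete : ObjectProperty CCat.{v, u} := fun C => IsDiscrete C

/-! ### Hammock localisation -/

/-- Zigzags in `C` ending at `z`, in which the arrows that go backwards are coloured. -/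
inductive Zigzag (C : CCat.{v, u}) (z : C) : C → Type (max u v)
  | nil : Zigzag C z z
  | fwd {x y : C} (f : x ⟶ y) (h : Zigzag C z y) : Zigzag C z x
  | bwd {x y : C} (w : y ⟶ x) (hw : C.equi w) (h : Zigzag C z y) : Zigzag C z x

namespace Zigzag

variable {C D E : CCat.{v, u}}

/-- The elementary reductions of zigzags: omit an identity, compose two consecutive arrows that go
in the same direction. -/
inductive Step {z : C} : {x : C} → Zigzag C z x → Zigzag C z x → Prop
  | fwd_id {x : C} (h : Zigzag C z x) : Step (.fwd (𝟙 x) h) h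
  | bwd_id {x : C} (hx : C.equi (𝟙 x)) (h : Zigzag C z x) : Step (.bwd (𝟙 x) hx h) h
  | fwd_fwd {x y y' : C} (f : x ⟶ y) (g : y ⟶ y') (h : Zigzag C z y') :
      Step (.fwd f (.fwd g h)) (.fwd (f ≫ g) h)
  | bwd_bwd {x y y' : C} (w : y ⟶ x) (hw : C.equi w) (w' : y' ⟶ y) (hw' : C.equi w')
      (h : Zigzag C z y') :
      Step (.bwd w hw (.bwd w' hw' h)) (.bwd (w' ≫ w) (C.equi.comp_mem _ _ hw' hw) h)
  | fwd_congr {x y : C} (f : x ⟶ y) {h h' : Zigzag C z y} (s : Step h h') :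
      Step (.fwd f h) (.fwd f h')
  | bwd_congr {x y : C} (w : y ⟶ x) (hw : C.equi w) {h h' : Zigzag C z y} (s : Step h h') :
      Step (.bwd w hw h) (.bwd w hw h')

/-- Concatenation of zigzags. -/
def append {y z : C} : {x : C} → Zigzag C y x → Zigzag C z y → Zigzag C z x
  | _, .nil, k => k
  | _, .fwd f h, k => .fwd f (append h k)
  | _, .bwd w hw h, k => .bwd w hw (append h k)

lemma append_nil {z x : C} (h : Zigzag C z x) : append h .nil = h := by
  induction h with
  | nil => rfl
  | fwd f h ih => simp [append, ih]
  | bwd w hw h ih => simp [append, ih]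

lemma append_assoc {y z t x : C} (h : Zigzag C y x) (k : Zigzag C z y) (l : Zigzag C t z) :
    append (append h k) l = append h (append k l) := by
  induction h with
  | nil => rfl
  | fwd f h ih => simp [append, ih]
  | bwd w hw h ih => simp [append, ih]

lemma Step.append_left {x y z : C} (h : Zigzag C y x) {k k' : Zigzag C z y} (s : Step k k') :
    Step (append h k) (append h k') := by
  induction h with
  | nil => exact s
  | fwd f h ih => exact .fwd_congr f ih
  | bwd w hw h ih => exact .bwd_congr w hw ih

lemma Step.append_right {x y z : C} {h h' : Zigzag C y x} (s : Step h h') (k : Zigzag C z y) :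
    Step (append h k) (append h' k) := by
  induction s with
  | fwd_id h => exact .fwd_id _
  | bwd_id hx h => exact .bwd_id hx _
  | fwd_fwd f g h => exact .fwd_fwd f g _
  | bwd_bwd w hw w' hw' h => exact .bwd_bwd w hw w' hw' _
  | fwd_congr f s ih => exact .fwd_congr f ih
  | bwd_congr w hw s ih => exact .bwd_congr w hw ih

/-- The image of a zigzag under a colour-preserving functor. -/
def map (φ : C ⟶ D) {z : C} : {x : C} → Zigzag C z x → Zigzag D ((functor φ).obj z) ((functor φ).obj x)
  | _, .nil => .nil
  | _, .fwd f h => .fwd ((functor φ).map f) (map φ h)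
  | _, .bwd w hw h => .bwd ((functor φ).map w) (functor_map_equi φ hw) (map φ h)

lemma Step.map (φ : C ⟶ D) {z x : C} {h h' : Zigzag C z x} (s : Step h h') :
    Step (Zigzag.map φ h) (Zigzag.map φ h') := by
  induction s with
  | fwd_id h => simpa [Zigzag.map] using Step.fwd_id (Zigzag.map φ h)
  | bwd_id hx h =>
    simpa [Zigzag.map] using Step.bwd_id (D.equi.id_mem _) (Zigzag.map φ h)
  | fwd_fwd f g h =>
    simpa [Zigzag.map] using Step.fwd_fwd ((functor φ).map f) ((functor φ).map g) (Zigzag.map φ h)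
  | bwd_bwd w hw w' hw' h =>
    simpa [Zigzag.map] using Step.bwd_bwd _ (functor_map_equi φ hw) _ (functor_map_equi φ hw')
      (Zigzag.map φ h)
  | fwd_congr f s ih => exact .fwd_congr _ ih
  | bwd_congr w hw s ih => exact .bwd_congr _ _ ih

lemma map_append (φ : C ⟶ D) {y z x : C} (h : Zigzag C y x) (k : Zigzag C z y) :
    map φ (append h k) = append (map φ h) (map φ k) := by
  induction h with
  | nil => rfl
  | fwd f h ih => simp [append, map, ih]
  | bwd w hw h ih => simp [append, map, ih]

lemma map_id {z x : C} (h : Zigzag C z x) : map (𝟙 C) h = h := by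
  induction h with
  | nil => rfl
  | fwd f h ih => exact congrArg (Zigzag.fwd f) ih
  | bwd w hw h ih => exact congrArg (Zigzag.bwd w hw) ih

lemma map_comp (φ : C ⟶ D) (ψ : D ⟶ E) {z x : C} (h : Zigzag C z x) :
    map (φ ≫ ψ) h = map ψ (map φ h) := by
  induction h with
  | nil => rfl
  | fwd f h ih => exact congrArg (Zigzag.fwd ((functor (φ ≫ ψ)).map f)) ih
  | bwd w hw h ih =>
    exact congrArg (Zigzag.bwd ((functor (φ ≫ ψ)).map w) (functor_map_equi (φ ≫ ψ) hw)) ih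

/-- Zigzags from `x` to `z`, up to reduction. -/
def Reduced (C : CCat.{v, u}) (x z : C) : Type (max u v) := Quot (Step (C := C) (z := z) (x := x))

/-- The map induced on reduced zigzags by a colour-preserving functor. -/
def Reduced.map (φ : C ⟶ D) {x z : C} :
    Reduced C x z → Reduced D ((functor φ).obj x) ((functor φ).obj z) :=
  Quot.map (Zigzag.map φ) (fun _ _ s => s.map φ)

/-- Concatenation of reduced zigzags. -/
def Reduced.comp {x y z : C} : Reduced C x y → Reduced C y z → Reduced C x z :=
  Quot.map₂ append (fun h _ _ s => s.append_left h) (fun _ _ k s => s.append_right k)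

/-- Transport of reduced zigzags along equalities of the end points. -/
def Reduced.cast {x x' z z' : C} (hx : x = x') (hz : z = z') (h : Reduced C x z) :
    Reduced C x' z' :=
  hx ▸ hz ▸ h

lemma Reduced.map_cast (φ : C ⟶ D) {x x' z z' : C} (hx : x = x') (hz : z = z')
    (h : Reduced C x z) :
    Reduced.map φ (Reduced.cast hx hz h) =
      Reduced.cast (congrArg _ hx) (congrArg _ hz) (Reduced.map φ h) := by
  subst hx hz
  rfl

lemma Reduced.cast_comp {x x' y y' z z' : C} (hx : x = x') (hy : y = y') (hz : z = z')
    (h : Reduced C x y) (k : Reduced C y z) :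
    Reduced.cast hx hz (h.comp k) = (Reduced.cast hx hy h).comp (Reduced.cast hy hz k) := by
  subst hx hy hz
  rfl

lemma Reduced.cast_nil {x x' : C} (hx : x = x') :
    Reduced.cast hx hx (Quot.mk _ .nil) = Quot.mk _ .nil := by
  subst hx
  rfl

lemma Reduced.map_comp (φ : C ⟶ D) {x y z : C} (h : Reduced C x y) (k : Reduced C y z) :
    Reduced.map φ (h.comp k) = (Reduced.map φ h).comp (Reduced.map φ k) := by
  obtain ⟨h⟩ := h
  obtain ⟨k⟩ := k
  exact congrArg (Quot.mk _) (Zigzag.map_append φ h k)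

lemma Reduced.map_map (φ : C ⟶ D) (ψ : D ⟶ E) {x y : C} (h : Reduced C x y) :
    Reduced.map ψ (Reduced.map φ h) = Reduced.map (φ ≫ ψ) h := by
  obtain ⟨h⟩ := h
  exact congrArg (Quot.mk _) (Zigzag.map_comp φ ψ h).symm

end Zigzag

/-- The category of strings of `n` composable coloured arrows in `C`, whose arrows are the natural
transformations. -/
abbrev Strings (C : CCat.{v, u}) (n : SimplexCategory) : Type (max u v) :=
  ObjectProperty.FullSubcategory
    (fun F : Fin (n.len + 1) ⥤ C => ∀ ⦃i j : Fin (n.len + 1)⦄ (f : i ⟶ j), C.equi (F.map f))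

/-- The category of strings of `n` coloured arrows in `C`, the coloured transformations being
those with coloured components. -/
abbrev diag (C : CCat.{v, u}) (n : SimplexCategory) : CCat.{v, max u v} where
  carrier := C.Strings n
  equi := fun F G (α : F ⟶ G) => ∀ i, C.equi (α.hom.app i)
  isMultiplicative :=
    { id_mem := fun _ _ => C.equi.id_mem _
      comp_mem := fun _ _ hf hg i => C.equi.comp_mem _ _ (hf i) (hg i) }

/-- The string of identity arrows of `x`. -/
def constDiag (C : CCat.{v, u}) (n : SimplexCategory) (x : C) : C.diag n :=
  ⟨(Functor.const _).obj x, fun _ _ _ => C.equi.id_mem x⟩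

/-- The simplicial operators on strings of coloured arrows. -/
def diagRestrict (C : CCat.{v, u}) {m n : SimplexCategory} (θ : m ⟶ n) : C.diag n ⟶ C.diag m where
  functor :=
    { obj := fun (F : C.Strings n) =>
        (⟨θ.toOrderHom.monotone.functor ⋙ F.obj, fun _ _ _ => F.property _⟩ : C.Strings m)
      map := fun α => ⟨Functor.whiskerLeft θ.toOrderHom.monotone.functor α.hom⟩ }
  map := fun _ _ _ hα _ => hα _

/-- The map induced by a colour-preserving functor on strings of coloured arrows. -/
def diagMap {C D : CCat.{v, u}} (φ : C ⟶ D) (n : SimplexCategory) : C.diag n ⟶ D.diag n where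
  functor :=
    { obj := fun (F : C.Strings n) =>
        (⟨F.obj ⋙ functor φ, fun _ _ f => functor_map_equi φ (F.property f)⟩ : D.Strings n)
      map := fun α => ⟨Functor.whiskerRight α.hom (functor φ)⟩ }
  map := fun _ _ _ hα i => functor_map_equi φ (hα i)

lemma diagRestrict_id (C : CCat.{v, u}) (n : SimplexCategory) : C.diagRestrict (𝟙 n) = 𝟙 _ := rfl

lemma diagRestrict_comp (C : CCat.{v, u}) {l m n : SimplexCategory} (θ : l ⟶ m) (η : m ⟶ n) :
    C.diagRestrict (θ ≫ η) = C.diagRestrict η ≫ C.diagRestrict θ := rfl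

lemma diagRestrict_obj_const (C : CCat.{v, u}) {m n : SimplexCategory} (θ : m ⟶ n) (x : C) :
    (functor (C.diagRestrict θ)).obj (C.constDiag n x) = C.constDiag m x := rfl

lemma diagMap_naturality {C D : CCat.{v, u}} (φ : C ⟶ D) {m n : SimplexCategory} (θ : m ⟶ n) :
    C.diagRestrict θ ≫ diagMap φ m = diagMap φ n ≫ D.diagRestrict θ := rfl

lemma diagMap_obj_const {C D : CCat.{v, u}} (φ : C ⟶ D) (n : SimplexCategory) (x : C) :
    (functor (diagMap φ n)).obj (C.constDiag n x) = D.constDiag n ((functor φ).obj x) :=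
  ObjectProperty.FullSubcategory.ext (CategoryTheory.Functor.hext (fun _ => rfl)
    (fun _ _ _ => heq_of_eq ((functor φ).map_id x)))

/-- The mapping space `LC(x, y)` of the hammock localisation of `C`. Its `n`-simplices are the
reduced hammocks of width `n` from `x` to `y`, i.e. the reduced zigzags of strings of `n` coloured
arrows that start at the identities of `x` and end at the identities of `y`. -/
def mappingSpace (C : CCat.{v, u}) (x y : C) : SSet.{max u v} where
  obj n := Zigzag.Reduced (C.diag n.unop) (C.constDiag n.unop x) (C.constDiag n.unop y)
  map θ := ↾(Zigzag.Reduced.map (C.diagRestrict θ.unop))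
  map_id n := by
    ext ⟨h⟩
    exact congrArg (Quot.mk _) (Zigzag.map_id h)
  map_comp θ η := by
    ext ⟨h⟩
    exact congrArg (Quot.mk _) (Zigzag.map_comp (C.diagRestrict θ.unop) (C.diagRestrict η.unop) h)

/-- The map `LC(x, y) → LD(φ x, φ y)` induced by a colour-preserving functor `φ`. -/
def mappingSpaceMap {C D : CCat.{v, u}} (φ : C ⟶ D) (x y : C) :
    C.mappingSpace x y ⟶ D.mappingSpace ((functor φ).obj x) ((functor φ).obj y) where
  app n := ↾fun h => Zigzag.Reduced.cast (diagMap_obj_const φ n.unop x)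
    (diagMap_obj_const φ n.unop y) (Zigzag.Reduced.map (diagMap φ n.unop) h)
  naturality m n θ := by
    ext h
    have h₁ := Zigzag.Reduced.map_map (C.diagRestrict θ.unop) (diagMap φ n.unop) h
    have h₂ := Zigzag.Reduced.map_map (diagMap φ m.unop) (D.diagRestrict θ.unop) h
    have h₃ := Zigzag.Reduced.map_cast (D.diagRestrict θ.unop) (diagMap_obj_const φ m.unop x)
      (diagMap_obj_const φ m.unop y) (Zigzag.Reduced.map (diagMap φ m.unop) h)
    refine Eq.trans ?_ h₃.symm
    exact congrArg (Zigzag.Reduced.cast _ _) (h₁.trans h₂.symm)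

/-- The category of `0`-simplices of the hammock localisation: its objects are those of `C`, and its
arrows are the `0`-simplices of the mapping spaces, composed by concatenation. -/
structure Hammock₀ (C : CCat.{v, u}) where
  /-- the underlying object of `C` -/
  as : C

instance (C : CCat.{v, u}) : Category.{max u v} C.Hammock₀ where
  Hom x y := (C.mappingSpace x.as y.as).obj (op (SimplexCategory.mk 0))
  id x := Quot.mk _ .nil
  comp h k := Zigzag.Reduced.comp h k
  id_comp := by
    rintro _ _ ⟨h⟩
    rfl
  comp_id := by
    rintro _ _ ⟨h⟩
    exact congrArg (Quot.mk _) h.append_nil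
  assoc := by
    rintro _ _ _ _ ⟨h⟩ ⟨k⟩ ⟨l⟩
    exact congrArg (Quot.mk _) (h.append_assoc k l)

/-- Two `0`-simplices of a mapping space are related when some `1`-simplex joins them. -/
def homotopyRel (C : CCat.{v, u}) : HomRel C.Hammock₀ :=
  fun x y => SSet.π₀Rel (X := C.mappingSpace x.as y.as)

/-- The category `π₀ LC`: its objects are those of `C`, and its arrows from `x` to `y` are the
connected components of the mapping space `LC(x, y)`. -/
abbrev Pi₀ (C : CCat.{v, u}) := CategoryTheory.Quotient C.homotopyRel

/-- The functor induced by `φ` on categories of `0`-simplices. -/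
def hammock₀Map {C D : CCat.{v, u}} (φ : C ⟶ D) : C.Hammock₀ ⥤ D.Hammock₀ where
  obj x := ⟨(functor φ).obj x.as⟩
  map {x y} h := (mappingSpaceMap φ x.as y.as).app _ h
  map_id x := Zigzag.Reduced.cast_nil (diagMap_obj_const φ (SimplexCategory.mk 0) x.as)
  map_comp {x y z} h k :=
    (congrArg (Zigzag.Reduced.cast _ _)
      (Zigzag.Reduced.map_comp (diagMap φ (SimplexCategory.mk 0)) h k)).trans
    (Zigzag.Reduced.cast_comp (diagMap_obj_const φ (SimplexCategory.mk 0) x.as)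
      (diagMap_obj_const φ (SimplexCategory.mk 0) y.as)
      (diagMap_obj_const φ (SimplexCategory.mk 0) z.as) _ _)

/-- The functor `π₀ Lφ : π₀ LC ⥤ π₀ LD`. -/
def pi₀Map {C D : CCat.{v, u}} (φ : C ⟶ D) : C.Pi₀ ⥤ D.Pi₀ :=
  CategoryTheory.Quotient.lift C.homotopyRel
    (hammock₀Map φ ⋙ CategoryTheory.Quotient.functor D.homotopyRel)
    (fun x y _ _ ⟨e⟩ => CategoryTheory.Quotient.sound D.homotopyRel
      ⟨e.map (mappingSpaceMap φ x.as y.as)⟩)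

end CCat

/-- Homotopy classes of maps of simplicial sets (for the equivalence relation generated by
simplicial homotopies). -/
def SSet.HomotopyClasses (X Y : SSet.{u}) : Type u :=
  Quot (fun f g : X ⟶ Y => Nonempty (SSet.Homotopy f g))

/-- The map `[Y, Z] → [X, Z]` induced by `f : X ⟶ Y`. -/
def SSet.HomotopyClasses.precomp {X Y : SSet.{u}} (f : X ⟶ Y) (Z : SSet.{u}) :
    SSet.HomotopyClasses Y Z → SSet.HomotopyClasses X Z :=
  Quot.map (fun g => f ≫ g) (fun _ _ ⟨H⟩ =>
    ⟨SSet.RelativeMorphism.Homotopy.precomp H (SSet.RelativeMorphism.botEquiv.symm f)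
      (SSet.Subcomplex.isInitialBot.hom_ext _ _)⟩)

/-- Weak equivalences of simplicial sets: the maps `X ⟶ Y` that induce a bijection
`[Y, Z] → [X, Z]` for every Kan complex `Z`. -/
def SSet.IsWeakEquivalence {X Y : SSet.{u}} (f : X ⟶ Y) : Prop :=
  ∀ (Z : SSet.{u}) [SSet.KanComplex Z], Function.Bijective (SSet.HomotopyClasses.precomp f Z)

/-- The equifunctors: the colour-preserving functors that induce an equivalence of simplicial
categories on the simplicial localisations. -/
def CCat.equifunctors : MorphismProperty CCat.{v, u} := fun C _ φ =>
  (CCat.pi₀Map φ).IsEquivalence ∧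
    ∀ x y : C, SSet.IsWeakEquivalence (CCat.mappingSpaceMap φ x y)

/-! ## The fat delta -/

/-- The objects of the fat delta: the finite non-empty coloured semi-ordinals, i.e. the finite
strings of arrows, some of which (the links) are coloured. The vertices are `0, …, edges`, and the
edge `j` goes from the vertex `j.castSucc` to the vertex `j.succ`. -/
structure FatDelta where
  /-- the number of arrows in the string -/
  edges : ℕ
  /-- the coloured arrows -/
  linked : Fin edges → Bool

namespace FatDelta

/-- The arrow `a < b` of the coloured semi-ordinal `K` is coloured when all the edges between `a`
and `b` are. -/
def Equi (K : FatDelta) (a b : Fin (K.edges + 1)) : Prop :=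
  ∀ j : Fin K.edges, a ≤ j.castSucc → j.succ ≤ b → K.linked j = true

/-- The arrows of the fat delta: the strictly increasing maps on vertices that preserve the
coloured arrows. -/
@[ext]
structure Hom (K L : FatDelta) where
  /-- the map on vertices -/
  toFun : Fin (K.edges + 1) → Fin (L.edges + 1)
  strictMono : StrictMono toFun
  map_equi : ∀ a b, a < b → K.Equi a b → L.Equi (toFun a) (toFun b)

instance : Category FatDelta where
  Hom := Hom
  id K := ⟨id, strictMono_id, fun _ _ _ h => h⟩
  comp f g := ⟨g.toFun ∘ f.toFun, g.strictMono.comp f.strictMono,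
    fun _ _ hab h => g.map_equi _ _ (f.strictMono hab) (f.map_equi _ _ hab h)⟩

/-- The equi-connected component of the vertex `a`, the components being numbered from `0`
upwards: the number of uncoloured edges below `a`. -/
def component (K : FatDelta) (a : Fin (K.edges + 1)) : ℕ :=
  (Finset.univ.filter (fun j : Fin K.edges => j.castSucc < a ∧ K.linked j = false)).card

/-- The vertical arrows: those that induce an identity arrow on the ordinals of equi-connected
components. -/
def vertical : MorphismProperty FatDelta := fun K L f =>
  K.component (Fin.last _) = L.component (Fin.last _) ∧
    ∀ a, L.component (f.toFun a) = K.component a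

/-- The string of `n` uncoloured arrows. `hops 0` is the single dot. -/
def hops (n : ℕ) : FatDelta := ⟨n, fun _ => false⟩

/-- The string of `n` coloured arrows. -/
def links (n : ℕ) : FatDelta := ⟨n, fun _ => true⟩

/-- The single dot. -/
abbrev dot : FatDelta := hops 0

/-- Every strictly increasing map out of a string of uncoloured arrows preserves the colours. -/
def ofHops {n : ℕ} {K : FatDelta} (f : Fin (n + 1) → Fin (K.edges + 1)) (hf : StrictMono f) :
    hops n ⟶ K where
  toFun := f
  strictMono := hf
  map_equi a b hab h := by
    have ha : (a : ℕ) < n := lt_of_lt_of_le hab (Nat.lt_succ_iff.mp b.isLt)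
    exact absurd (h ⟨a, ha⟩ le_rfl hab) (by simp [hops])

/-- Every strictly increasing map into a string of coloured arrows preserves the colours. -/
def toLinks {n : ℕ} {K : FatDelta} (f : Fin (K.edges + 1) → Fin (n + 1)) (hf : StrictMono f) :
    K ⟶ links n where
  toFun := f
  strictMono := hf
  map_equi _ _ _ _ _ _ _ := rfl

/-- The first dot of `K`. -/
def first (K : FatDelta) : dot ⟶ K :=
  ofHops (fun _ => 0) (Subsingleton.strictMono (α := Fin 1) _)

/-- The last dot of `K`. -/
def last (K : FatDelta) : dot ⟶ K :=
  ofHops (fun _ => Fin.last _) (Subsingleton.strictMono (α := Fin 1) _)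

lemma strictMono_two {n : ℕ} {a b : Fin n} (hab : a < b) : StrictMono ![a, b] := by
  simpa [Fin.strictMono_iff_lt_succ] using hab

/-- The arrow from the vertex `a` to the vertex `b` of `K`. -/
def arrow (K : FatDelta) (a b : Fin (K.edges + 1)) (hab : a < b) : hops 1 ⟶ K :=
  ofHops ![a, b] (strictMono_two hab)

/-- The composable pair of arrows of `K` from `a` to `b` to `c`. -/
def pair (K : FatDelta) (a b c : Fin (K.edges + 1)) (hab : a < b) (hbc : b < c) : hops 2 ⟶ K :=
  ofHops ![a, b, c] (by
    rw [Fin.strictMono_iff_lt_succ]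
    intro i
    fin_cases i
    exacts [hab, hbc])

/-- The coloured arrow from the vertex `a` to the vertex `b` of a string of links. -/
def link {n : ℕ} (a b : Fin (n + 1)) (hab : a < b) : links 1 ⟶ links n :=
  toLinks (K := links 1) ![a, b] (strictMono_two hab)

end FatDelta

/-! ## Fair categories and fair monoids -/

/-- A fair category in a category `S` with coloured arrows `equi` and discrete objects `disc`:
a diagram on the opposite of the fat delta that preserves the discrete objects (the single dot is
the only discrete object of the fat delta), the colours, and the fibre products over discrete
objects (i.e. it sends the pushouts of the last dot of `K` with the first dot of `L` to
pullbacks). -/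
structure IsFairCategory {S : Type*} [Category* S] (equi : MorphismProperty S)
    (disc : ObjectProperty S) (X : FatDeltaᵒᵖ ⥤ S) : Prop where
  discrete : disc (X.obj (op FatDelta.dot))
  segal : ∀ {K L P : FatDelta} (i : K ⟶ P) (j : L ⟶ P), IsPushout K.last L.first i j →
    IsPullback (X.map i.op) (X.map j.op) (X.map K.last.op) (X.map L.first.op)
  colours : ∀ {K L : FatDelta} (f : K ⟶ L), FatDelta.vertical f → equi (X.map f.op)

/-- A fair monoid in coloured categories, or fair monoidal coloured category: a fair category in
`CCat`, for the equifunctors, whose space of objects is a singleton. -/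
structure IsFairMonoid (X : FatDeltaᵒᵖ ⥤ CCat.{v, u}) : Prop extends
    IsFairCategory CCat.equifunctors CCat.discrete X where
  singleton : Nonempty (Unique (X.obj (op FatDelta.dot)))

namespace FatDelta

variable (X : FatDeltaᵒᵖ ⥤ CCat.{v, u})

/-- The functor `X L ⥤ X K` given by an arrow `K ⟶ L` of the fat delta. -/
abbrev res {K L : FatDelta} (f : K ⟶ L) : X.obj (op L) ⥤ X.obj (op K) := CCat.functor (X.map f.op)

lemma res_res_obj {K L P : FatDelta} {f : K ⟶ L} {g : L ⟶ P} {h : K ⟶ P} (w : f ≫ g = h)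
    (T : X.obj (op P)) : (res X f).obj ((res X g).obj T) = (res X h).obj T := by
  subst w
  exact (congrArg (fun φ => (CCat.functor φ).obj T) (X.map_comp g.op f.op)).symm

lemma arrow_pair₀₁ (K : FatDelta) (a b c : Fin (K.edges + 1)) (hab : a < b) (hbc : b < c) :
    arrow (hops 2) (0 : Fin 3) (1 : Fin 3) (by decide) ≫ pair K a b c hab hbc = arrow K a b hab := by
  apply Hom.ext
  funext i
  fin_cases i <;> rfl

lemma arrow_pair₁₂ (K : FatDelta) (a b c : Fin (K.edges + 1)) (hab : a < b) (hbc : b < c) :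
    arrow (hops 2) (1 : Fin 3) (2 : Fin 3) (by decide) ≫ pair K a b c hab hbc = arrow K b c hbc := by
  apply Hom.ext
  funext i
  fin_cases i <;> rfl

lemma arrow_pair₀₂ (K : FatDelta) (a b c : Fin (K.edges + 1)) (hab : a < b) (hbc : b < c) :
    arrow (hops 2) (0 : Fin 3) (2 : Fin 3) (by decide) ≫ pair K a b c hab hbc =
      arrow K a c (hab.trans hbc) := by
  apply Hom.ext
  funext i
  fin_cases i <;> rfl

lemma arrow_link {n : ℕ} (a b : Fin (n + 1)) (hab : a < b) :
    arrow (links 1) (0 : Fin 2) (1 : Fin 2) (by decide) ≫ link a b hab =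
      arrow (links n) a b hab := by
  apply Hom.ext
  funext i
  fin_cases i <;> rfl

end FatDelta

/-! ## Monoidal model categories -/

section

variable (M : Type u) [Category.{v} M] [MonoidalCategory M] [ModelCategory M]

/-- Monoidal model categories in the sense of Hovey: the factorisations of the model structure can
be chosen functorial, the tensor product is closed on both sides, it satisfies the pushout-product
axiom, and it satisfies the unit axiom. The unit object need not be cofibrant. -/
class MonoidalModelCategory : Prop where
  functorial₁ : MorphismProperty.HasFunctorialFactorization (cofibrations M) (trivialFibrations M)
  functorial₂ : MorphismProperty.HasFunctorialFactorization (trivialCofibrations M) (fibrations M)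
  closed_left (X : M) : (tensorLeft X).IsLeftAdjoint
  closed_right (X : M) : (tensorRight X).IsLeftAdjoint
  pushoutProduct_cofibration (i j : Arrow M) : Cofibration i.hom → Cofibration j.hom →
    Cofibration ((MonoidalCategory.Arrow.pushoutProduct.obj i).obj j).hom
  pushoutProduct_weakEquivalence (i j : Arrow M) : Cofibration i.hom → Cofibration j.hom →
    WeakEquivalence i.hom ∨ WeakEquivalence j.hom →
    WeakEquivalence ((MonoidalCategory.Arrow.pushoutProduct.obj i).obj j).hom
  unit_left {Z : M} (w : Z ⟶ 𝟙_ M) (X : M) : IsCofibrant Z → WeakEquivalence w → IsCofibrant X →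
    WeakEquivalence (w ▷ X ≫ (λ_ X).hom)
  unit_right {Z : M} (w : Z ⟶ 𝟙_ M) (X : M) : IsCofibrant Z → WeakEquivalence w → IsCofibrant X →
    WeakEquivalence (X ◁ w ≫ (ρ_ X).hom)

/-- The tensor product of `M` is strictly associative. -/
def StrictlyAssociative : Prop :=
  ∀ X Y Z : M, ∃ h : (X ⊗ Y) ⊗ Z = X ⊗ Y ⊗ Z, (α_ X Y Z).hom = eqToHom h

/-- The category of weak units of `M`: its objects are the weak equivalences `Z ⟶ 𝟙_ M` with `Z`
cofibrant, its arrows are the triangles over `𝟙_ M`. -/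
abbrev WeakUnits : Type (max u v) :=
  ObjectProperty.FullSubcategory
    (fun w : CostructuredArrow (CofibrantObject.ι (C := M)) (𝟙_ M) => WeakEquivalence w.hom)

variable {M}

/-- The functor into the category of weak units given by a functor `G` into the cofibrant objects
and a natural weak equivalence from `G` to the unit object. -/
def toWeakUnits {Y : Type*} [Category* Y] (G : Y ⥤ CofibrantObject M)
    (ε : G ⋙ CofibrantObject.ι ⟶ (Functor.const Y).obj (𝟙_ M))
    (hε : ∀ S, WeakEquivalence (ε.app S)) : Y ⥤ WeakUnits M where
  obj S := ⟨CostructuredArrow.mk (S := CofibrantObject.ι) (ε.app S), hε S⟩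
  map f := ⟨CostructuredArrow.homMk (G.map f) (by simpa using ε.naturality f)⟩

variable (M)

namespace FatDelta

/-- A functor `F` from the space of arrows of `X` to the cofibrant objects of `M`, together with a
natural isomorphism `μ` between the composition law of `X` and the tensor product of `M`. -/
structure TensorData (X : FatDeltaᵒᵖ ⥤ CCat.{v, max u v}) where
  /-- the functor to the cofibrant objects -/
  F : X.obj (op (hops 1)) ⥤ CofibrantObject M
  /-- the comparison of the composition law with the tensor product -/
  μ : res X (arrow (hops 2) (0 : Fin 3) (2 : Fin 3) (by decide)) ⋙ F ⋙ CofibrantObject.ι ≅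
    Functor.prod'
      (res X (arrow (hops 2) (0 : Fin 3) (1 : Fin 3) (by decide)) ⋙ F ⋙ CofibrantObject.ι)
      (res X (arrow (hops 2) (1 : Fin 3) (2 : Fin 3) (by decide)) ⋙ F ⋙ CofibrantObject.ι) ⋙
    MonoidalCategory.tensor M

namespace TensorData

variable {M} {X : FatDeltaᵒᵖ ⥤ CCat.{v, max u v}} (R : TensorData M X)

/-- The object of `M` underlying an arrow of `X`. -/
def obj (a : X.obj (op (hops 1))) : M := (R.F.obj a).obj

/-- The object of `M` underlying the arrow from `a` to `b` of a diagram `T` of shape `K`. -/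
def edge {K : FatDelta} (T : X.obj (op K)) (a b : Fin (K.edges + 1)) (hab : a < b) : M :=
  R.obj ((res X (arrow K a b hab)).obj T)

/-- The isomorphism `T_ac ≅ T_ab ⊗ T_bc` given by `μ`, for a diagram `T` of shape `K` and vertices
`a < b < c` of `K`. -/
def mul {K : FatDelta} (T : X.obj (op K)) (a b c : Fin (K.edges + 1)) (hab : a < b) (hbc : b < c) :
    R.edge T a c (hab.trans hbc) ⟶ R.edge T a b hab ⊗ R.edge T b c hbc :=
  eqToHom (congrArg R.obj (res_res_obj X (arrow_pair₀₂ K a b c hab hbc) T).symm) ≫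
    R.μ.hom.app ((res X (pair K a b c hab hbc)).obj T) ≫
    (eqToHom (congrArg R.obj (res_res_obj X (arrow_pair₀₁ K a b c hab hbc) T)) ⊗ₘ
      eqToHom (congrArg R.obj (res_res_obj X (arrow_pair₁₂ K a b c hab hbc) T)))

end TensorData

end FatDelta

open FatDelta in
/-- The datum that exhibits a diagram `X` on the opposite of the fat delta as being the fair monoid
of cofibrant objects of `M`.

* The coloured category `A = X (hops 1)` is identified, by the equivalence `F`, with the category of
  cofibrant objects of `M`, coloured by the weak equivalences.
* The composition law of `A` is identified, by the natural isomorphism `μ`, with the tensor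
  product, compatibly with the associativity constraint.
* The coloured category `U = X (links 1)` is identified, by means of `ε`, with the category of
  weak equivalences `Z ⟶ 𝟙_ M` with `Z` cofibrant, all of whose arrows are coloured, in such a way
  that `U ⥤ A` is the functor `(Z ⟶ 𝟙_ M) ↦ Z` and that the composition law of `U` sends the pair
  `(Z ⟶ 𝟙_ M, Z' ⟶ 𝟙_ M)` to the composite `Z ⊗ Z' ⟶ 𝟙_ M ⊗ 𝟙_ M ⟶ 𝟙_ M`. -/
structure CofibrantFairMonoid (X : FatDeltaᵒᵖ ⥤ CCat.{v, max u v}) extends TensorData M X where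
  isEquivalence : F.IsEquivalence
  equi_iff : ∀ {a b : X.obj (op (hops 1))} (f : a ⟶ b),
    (X.obj (op (hops 1))).equi f ↔ WeakEquivalence (CofibrantObject.ι.map (F.map f))
  associativity : ∀ T : X.obj (op (hops 3)),
    toTensorData.mul T (0 : Fin 4) (1 : Fin 4) (3 : Fin 4) (by decide) (by decide) ≫
        (_ ◁ toTensorData.mul T (1 : Fin 4) (2 : Fin 4) (3 : Fin 4) (by decide) (by decide)) =
      toTensorData.mul T (0 : Fin 4) (2 : Fin 4) (3 : Fin 4) (by decide) (by decide) ≫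
        (toTensorData.mul T (0 : Fin 4) (1 : Fin 4) (2 : Fin 4) (by decide) (by decide) ▷ _) ≫
        (α_ _ _ _).hom
  /-- the weak equivalences `Z ⟶ 𝟙_ M` that correspond to the objects of `U` -/
  ε : (res X (arrow (links 1) (0 : Fin 2) (1 : Fin 2) (by decide)) ⋙ F) ⋙ CofibrantObject.ι ⟶
    (Functor.const _).obj (𝟙_ M)
  ε_weakEquivalence : ∀ S, WeakEquivalence (ε.app S)
  isEquivalence_units : (toWeakUnits _ ε ε_weakEquivalence).IsEquivalence
  equi_units : (X.obj (op (links 1))).equi = ⊤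
  unit_mul : ∀ T : X.obj (op (links 2)),
    eqToHom (congrArg toTensorData.obj
        (res_res_obj X (arrow_link (0 : Fin 3) (2 : Fin 3) (by decide)) T).symm) ≫
      ε.app ((res X (link (0 : Fin 3) (2 : Fin 3) (by decide))).obj T) =
    toTensorData.mul T (0 : Fin 3) (1 : Fin 3) (2 : Fin 3) (by decide) (by decide) ≫
      ((eqToHom (congrArg toTensorData.obj
          (res_res_obj X (arrow_link (0 : Fin 3) (1 : Fin 3) (by decide)) T).symm) ≫
        ε.app ((res X (link (0 : Fin 3) (1 : Fin 3) (by decide))).obj T)) ⊗ₘ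
      (eqToHom (congrArg toTensorData.obj
          (res_res_obj X (arrow_link (1 : Fin 3) (2 : Fin 3) (by decide)) T).symm) ≫
        ε.app ((res X (link (1 : Fin 3) (2 : Fin 3) (by decide))).obj T))) ≫
      (λ_ (𝟙_ M)).hom

variable {M} in
/-- The identifications of a `CofibrantFairMonoid` hold on the nose: `A` and `U` are isomorphic to
the categories of cofibrant objects and of weak units, and the composition law is equal to the
tensor product. -/
structure CofibrantFairMonoid.IsStrict {X : FatDeltaᵒᵖ ⥤ CCat.{v, max u v}}
    (R : CofibrantFairMonoid M X) : Prop where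
  bijective : Function.Bijective R.F.obj
  bijective_units : Function.Bijective (toWeakUnits _ R.ε R.ε_weakEquivalence).obj
  μ_eq : ∀ T, ∃ h, R.μ.hom.app T = eqToHom h

end

end

/-!
Replace the cofibrant objects by a semigroup `S` of names for them whose product represents `⊗` up
to coherent isomorphism: non-empty lists of cofibrant objects, or the cofibrant objects themselves
when `⊗` is strictly associative. The value of `X` at a semi-ordinal `K` consists of the diagrams on
the edges of `K` that take composable edges to products in `S` and coloured edges to objects
weakly equivalent to `I`; as such a diagram is determined by its restriction to elementary edges,
the Segal condition holds on the nose.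

A vertical arrow is a bijection on elementary uncoloured edges. Dropping the coloured edges is an
isomorphism in the homotopy category of coloured categories: the coloured edges form a product of
categories of weak units, which is contractible because a functorial factorisation of
`Z ⊔ z → I` joins every weak unit `Z` to a fixed one `z` by a zigzag of coloured natural
transformations, and tensoring with weak units changes a cofibrant object only by a weak
equivalence. Coloured natural transformations induce homotopies on the mapping spaces of the hammock
localisation, so every isomorphism of the homotopy category is represented by equifunctors.
-/

noncomputable section

/-! ## Simplicial homotopies -/

section

open Simplicial

variable {X Y Z : SSet.{u}} {f g : X ⟶ Y}

/-- The simplicial homotopy given by a family of operations on the simplices of `X`, indexed by the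
simplices of `Δ[1]`. -/
def homotopyOfOperations (H : ∀ n : SimplexCategory, (n ⟶ ⦋1⦌) → X.obj (op n) → Y.obj (op n))
    (naturality : ∀ {m n : SimplexCategory} (θ : m ⟶ n) (k : n ⟶ ⦋1⦌) (x : X.obj (op n)),
      Y.map θ.op (H n k x) = H m (θ ≫ k) (X.map θ.op x))
    (zero : ∀ n x, H n (SimplexCategory.const n ⦋1⦌ 0) x = f.app _ x)
    (one : ∀ n x, H n (SimplexCategory.const n ⦋1⦌ 1) x = g.app _ x) : SSet.Homotopy f g where
  h :=
    { app n := ↾fun x => H n.unop (SSet.stdSimplex.objEquiv x.2) x.1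
      naturality m n θ := by
        ext x
        exact (naturality θ.unop (SSet.stdSimplex.objEquiv x.2) x.1).symm }
  h₀ := by
    ext n x
    exact zero n.unop x
  h₁ := by
    ext n x
    exact one n.unop x
  rel := by
    ext n ⟨⟨x, hx⟩, y⟩
    exact hx.elim

lemma homotopy_π₀Rel (H : SSet.Homotopy f g) (x : X _⦋0⦌) :
    SSet.π₀Rel (f.app _ x) (g.app _ x) := by
  have h₀ : Δ[1].δ 1 (SSet.stdSimplex.objEquiv.symm (𝟙 ⦋1⦌)) =
      SSet.stdSimplex.obj₀Equiv.symm 0 := by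
    ext i; fin_cases i; rfl
  have h₁ : Δ[1].δ 0 (SSet.stdSimplex.objEquiv.symm (𝟙 ⦋1⦌)) =
      SSet.stdSimplex.obj₀Equiv.symm 1 := by
    ext i; fin_cases i; rfl
  let e : SSet.Edge (X := X ⊗ Δ[1]) (x, SSet.stdSimplex.obj₀Equiv.symm 0)
      (x, SSet.stdSimplex.obj₀Equiv.symm 1) :=
    .ofTruncated ((SSet.Edge.id x).toTruncated.tensor (SSet.Edge.mk _ h₀ h₁).toTruncated)
  refine ⟨(e.map H.h).ofEq ?_ ?_⟩
  exacts [congrArg (fun t => t.app (op ⦋0⦌) x) H.h₀, congrArg (fun t => t.app (op ⦋0⦌) x) H.h₁]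

lemma homotopyClasses_precomp_comp (f : X ⟶ Y) (g : Y ⟶ Z) (T : SSet.{u}) :
    SSet.HomotopyClasses.precomp (f ≫ g) T =
      SSet.HomotopyClasses.precomp f T ∘ SSet.HomotopyClasses.precomp g T := by
  funext h
  obtain ⟨h⟩ := h
  exact congrArg (Quot.mk _) (Category.assoc f g h)

lemma homotopyClasses_precomp_id (X T : SSet.{u}) :
    SSet.HomotopyClasses.precomp (𝟙 X) T = id := by
  funext h
  obtain ⟨h⟩ := h
  exact congrArg (Quot.mk _) (Category.id_comp h)

lemma homotopyClasses_precomp_eq (H : SSet.Homotopy f g) (T : SSet.{u}) :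
    SSet.HomotopyClasses.precomp f T = SSet.HomotopyClasses.precomp g T := by
  funext h
  obtain ⟨h⟩ := h
  exact Quot.sound ⟨SSet.RelativeMorphism.Homotopy.postcomp H
    (SSet.RelativeMorphism.botEquiv.symm h) (SSet.Subcomplex.isInitialBot.hom_ext _ _)⟩

lemma bijective_homotopyClasses_precomp {f : X ⟶ Y} {g : Y ⟶ X} {T : SSet.{u}}
    (h₁ : SSet.HomotopyClasses.precomp (f ≫ g) T = id)
    (h₂ : SSet.HomotopyClasses.precomp (g ≫ f) T = id) :
    Function.Bijective (SSet.HomotopyClasses.precomp f T) := by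
  rw [homotopyClasses_precomp_comp] at h₁ h₂
  exact Function.bijective_iff_has_inverse.mpr ⟨_, congrFun h₂, congrFun h₁⟩

lemma map_map_const {m n : SimplexCategoryᵒᵖ} (θ : m ⟶ n) (x : X _⦋0⦌) :
    X.map θ (X.map (SimplexCategory.const m.unop ⦋0⦌ 0).op x) =
      X.map (SimplexCategory.const n.unop ⦋0⦌ 0).op x :=
  (ConcreteCategory.congr_hom (X.map_comp _ θ) x).symm

lemma map_const_edge_src {x y : X _⦋0⦌} (e : SSet.Edge x y) (n : SimplexCategory) :
    X.map (SimplexCategory.const n ⦋1⦌ 0).op e.edge =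
      X.map (SimplexCategory.const n ⦋0⦌ 0).op x := by
  have h : SimplexCategory.const n ⦋1⦌ 0 =
      SimplexCategory.const n ⦋0⦌ 0 ≫ SimplexCategory.δ 1 := by
    ext i; rfl
  rw [h, op_comp, X.map_comp]
  exact congrArg (X.map _) e.src_eq

lemma map_const_edge_tgt {x y : X _⦋0⦌} (e : SSet.Edge x y) (n : SimplexCategory) :
    X.map (SimplexCategory.const n ⦋1⦌ 1).op e.edge =
      X.map (SimplexCategory.const n ⦋0⦌ 0).op y := by
  have h : SimplexCategory.const n ⦋1⦌ 1 =
      SimplexCategory.const n ⦋0⦌ 0 ≫ SimplexCategory.δ 0 := by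
    ext i; rfl
  rw [h, op_comp, X.map_comp]
  exact congrArg (X.map _) e.tgt_eq

end

/-! ## Mapping spaces of the hammock localisation -/

namespace CCat

variable {C D : CCat.{v, u}}

namespace Zigzag.Reduced

/-- The empty zigzag, up to reduction. -/
def nil (x : C) : Reduced C x x := Quot.mk _ .nil

/-- The reduced zigzag that consists of an arrow. -/
def fwd {x y : C} (f : x ⟶ y) : Reduced C x y := Quot.mk _ (.fwd f .nil)

/-- The reduced zigzag that consists of a coloured arrow, taken backwards. -/
def bwd {x y : C} (w : x ⟶ y) (hw : C.equi w) : Reduced C y x := Quot.mk _ (.bwd w hw .nil)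

lemma comp_assoc {x y z t : C} (h : Reduced C x y) (k : Reduced C y z) (l : Reduced C z t) :
    (h.comp k).comp l = h.comp (k.comp l) := by
  obtain ⟨h⟩ := h
  obtain ⟨k⟩ := k
  obtain ⟨l⟩ := l
  exact congrArg (Quot.mk _) (h.append_assoc k l)

lemma comp_nil {x y : C} (h : Reduced C x y) : h.comp (nil y) = h := by
  obtain ⟨h⟩ := h
  exact congrArg (Quot.mk _) h.append_nil

lemma nil_comp {x y : C} (h : Reduced C x y) : (nil x).comp h = h := by
  obtain ⟨h⟩ := h
  rfl

lemma fwd_id (x : C) : fwd (𝟙 x) = nil x :=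
  Quot.sound (.fwd_id _)

lemma bwd_id {x : C} (hx : C.equi (𝟙 x)) : bwd (𝟙 x) hx = nil x :=
  Quot.sound (.bwd_id _ _)

lemma fwd_comp_comp_fwd_congr {x x' y y' z t : C} {f : z ⟶ x} {f' : z ⟶ x'} {h : Reduced C x y}
    {h' : Reduced C x' y'} {g : y ⟶ t} {g' : y' ⟶ t} (hx : x = x') (hy : y = y') (hf : f ≍ f')
    (hh : cast hx hy h = h') (hg : g ≍ g') :
    (fwd f).comp (h.comp (fwd g)) = (fwd f').comp (h'.comp (fwd g')) := by
  subst hx hy hh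
  obtain rfl := eq_of_heq hf
  obtain rfl := eq_of_heq hg
  rfl

lemma cast_cast {x x' x'' y y' y'' : C} (hx : x = x') (hx' : x' = x'') (hy : y = y')
    (hy' : y' = y'') (h : Reduced C x y) :
    cast hx' hy' (cast hx hy h) = cast (hx.trans hx') (hy.trans hy') h := by
  subst hx hx' hy hy'
  rfl

lemma map_congr {φ ψ : C ⟶ D} (e : φ = ψ) {x y : C} (h : Reduced C x y) :
    map φ h = cast (by rw [e]) (by rw [e]) (map ψ h) := by
  subst e
  rfl

end Zigzag.Reduced

open Zigzag Simplicial

lemma Strings.hom_ext {n : SimplexCategory} {F G : C.diag n} {f g : F ⟶ G}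
    (h : ∀ i, f.hom.app i = g.hom.app i) : f = g := by
  ext i
  exact h i

lemma Strings.hom_hext {n : SimplexCategory} {F F' G G' : C.diag n} (hF : F = F') (hG : G = G')
    {f : F ⟶ G} {f' : F' ⟶ G'} (h : ∀ i, f.hom.app i ≍ f'.hom.app i) : f ≍ f' := by
  subst hF hG
  exact heq_of_eq (Strings.hom_ext fun i => eq_of_heq (h i))

lemma Strings.exists_constDiag_eq (F : C.diag ⦋0⦌) : ∃ x, C.constDiag ⦋0⦌ x = F := by
  have hobj (i : Fin 1) : F.obj.obj 0 = F.obj.obj i := by rw [Subsingleton.elim i 0]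
  refine ⟨F.obj.obj 0,
    ObjectProperty.FullSubcategory.ext (CategoryTheory.Functor.hext hobj fun i j f => ?_)⟩
  obtain rfl : i = 0 := Subsingleton.elim (α := Fin 1) i 0
  obtain rfl : j = 0 := Subsingleton.elim (α := Fin 1) j 0
  rw [Subsingleton.elim f (𝟙 _), F.obj.map_id]
  rfl

/-- The transformation of constant strings given by an arrow. -/
def constMap (n : SimplexCategory) {x y : C} (f : x ⟶ y) : C.constDiag n x ⟶ C.constDiag n y :=
  ⟨(Functor.const _).map f⟩

lemma Strings.exists_constMap_eq {x y : C} (f : C.constDiag ⦋0⦌ x ⟶ C.constDiag ⦋0⦌ y) :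
    ∃ g, constMap ⦋0⦌ g = f := by
  refine ⟨f.hom.app 0, Strings.hom_ext fun i => ?_⟩
  obtain rfl : i = 0 := Subsingleton.elim (α := Fin 1) i 0
  rfl

lemma mappingSpace_map_comp {x y z : C} {m n : SimplexCategoryᵒᵖ} (θ : m ⟶ n)
    (h : (C.mappingSpace x y).obj m) (k : (C.mappingSpace y z).obj m) :
    (C.mappingSpace x z).map θ (Reduced.comp h k) =
      Reduced.comp ((C.mappingSpace x y).map θ h) ((C.mappingSpace y z).map θ k) :=
  Reduced.map_comp (C.diagRestrict θ.unop) h k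

/-- Concatenation with a fixed `0`-simplex on the right. -/
def postcomp (x : C) {y z : C.Hammock₀} (c : y ⟶ z) :
    C.mappingSpace x y.as ⟶ C.mappingSpace x z.as where
  app n := ↾fun h => Reduced.comp h
    ((C.mappingSpace y.as z.as).map (SimplexCategory.const n.unop ⦋0⦌ 0).op c)
  naturality m n θ := by
    ext h
    refine Eq.trans ?_ (mappingSpace_map_comp θ h _).symm
    rw [map_map_const]
    rfl

/-- Concatenation with a fixed `0`-simplex on the left. -/
def precomp {x y : C.Hammock₀} (c : x ⟶ y) (z : C) :
    C.mappingSpace y.as z ⟶ C.mappingSpace x.as z where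
  app n := ↾fun h => Reduced.comp
    ((C.mappingSpace x.as y.as).map (SimplexCategory.const n.unop ⦋0⦌ 0).op c) h
  naturality m n θ := by
    ext h
    refine Eq.trans ?_ (mappingSpace_map_comp θ _ h).symm
    rw [map_map_const]
    rfl

lemma postcomp_id (x : C) (y : C.Hammock₀) : postcomp x (𝟙 y) = 𝟙 _ := by
  ext n h
  exact Reduced.comp_nil h

lemma precomp_id (x : C.Hammock₀) (y : C) : precomp (𝟙 x) y = 𝟙 _ := by
  ext n h
  exact Reduced.nil_comp h

lemma postcomp_comp (x : C) {y z t : C.Hammock₀} (c : y ⟶ z) (d : z ⟶ t) :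
    postcomp x (c ≫ d) = postcomp x c ≫ postcomp x d := by
  ext n h
  refine (congrArg (Reduced.comp h) (Reduced.map_comp
    (C.diagRestrict (SimplexCategory.const n.unop ⦋0⦌ 0)) c d)).trans ?_
  exact (Reduced.comp_assoc h _ _).symm

lemma precomp_comp {x y z : C.Hammock₀} (c : x ⟶ y) (d : y ⟶ z) (t : C) :
    precomp (c ≫ d) t = precomp d t ≫ precomp c t := by
  ext n h
  refine (congrArg (fun s => Reduced.comp s h) (Reduced.map_comp
    (C.diagRestrict (SimplexCategory.const n.unop ⦋0⦌ 0)) c d)).trans ?_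
  exact Reduced.comp_assoc _ _ h

/-- A `1`-simplex from `c` to `d` makes concatenation with `c` and with `d` homotopic. -/
def postcompHomotopy (x : C) {y z : C.Hammock₀} {c d : y ⟶ z}
    (e : SSet.Edge (X := C.mappingSpace y.as z.as) c d) :
    SSet.Homotopy (postcomp x c) (postcomp x d) :=
  homotopyOfOperations (fun _ k h => Reduced.comp h ((C.mappingSpace y.as z.as).map k.op e.edge))
    (fun θ k h => (Reduced.map_comp (C.diagRestrict θ) h _).trans
      (congrArg (Reduced.comp _) (ConcreteCategory.congr_hom
        ((C.mappingSpace y.as z.as).map_comp k.op θ.op) e.edge).symm))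
    (fun n h => congrArg (Reduced.comp h) (map_const_edge_src e n))
    (fun n h => congrArg (Reduced.comp h) (map_const_edge_tgt e n))

/-- The counterpart of `postcompHomotopy` for concatenation on the left. -/
def precompHomotopy {x y : C.Hammock₀} {c d : x ⟶ y}
    (e : SSet.Edge (X := C.mappingSpace x.as y.as) c d) (z : C) :
    SSet.Homotopy (precomp c z) (precomp d z) :=
  homotopyOfOperations (fun _ k h => Reduced.comp ((C.mappingSpace x.as y.as).map k.op e.edge) h)
    (fun θ k h => (Reduced.map_comp (C.diagRestrict θ) _ h).trans
      (congrArg (fun t => Reduced.comp t _) (ConcreteCategory.congr_hom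
        ((C.mappingSpace x.as y.as).map_comp k.op θ.op) e.edge).symm))
    (fun n h => congrArg (fun t => Reduced.comp t h) (map_const_edge_src e n))
    (fun n h => congrArg (fun t => Reduced.comp t h) (map_const_edge_tgt e n))

/-- An arrow of `C`, seen as an arrow of the category of `0`-simplices. -/
def hammockFwd {x y : C} (f : x ⟶ y) : (⟨x⟩ : C.Hammock₀) ⟶ ⟨y⟩ :=
  Reduced.fwd (constMap ⦋0⦌ f)

/-- A coloured arrow of `C`, seen as a backward arrow of the category of `0`-simplices. -/
def hammockBwd {x y : C} (w : x ⟶ y) (hw : C.equi w) : (⟨y⟩ : C.Hammock₀) ⟶ ⟨x⟩ :=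
  Reduced.bwd (constMap ⦋0⦌ w) (fun _ => hw)

/-- The string that consists of one coloured arrow. -/
def arrowString {x y : C} (w : x ⟶ y) (hw : C.equi w) : C.diag ⦋1⦌ :=
  ⟨ComposableArrows.mk₁ w, fun i j f => by
    fin_cases i <;> fin_cases j
    exacts [C.equi.id_mem _, hw, (leOfHom f).not_gt Fin.zero_lt_one |>.elim, C.equi.id_mem _]⟩

/-- The transformation `(𝟙, w)` from the constant string on the source of `w` to `w`. -/
def constToArrow {x y : C} (w : x ⟶ y) (hw : C.equi w) :
    C.constDiag ⦋1⦌ x ⟶ arrowString w hw :=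
  ⟨ComposableArrows.homMk₁ (𝟙 x) w⟩

/-- The transformation `(w, 𝟙)` from `w` to the constant string on the target of `w`. -/
def arrowToConst {x y : C} (w : x ⟶ y) (hw : C.equi w) :
    arrowString w hw ⟶ C.constDiag ⦋1⦌ y :=
  ⟨ComposableArrows.homMk₁ w (𝟙 y)⟩

lemma equi_constToArrow {x y : C} (w : x ⟶ y) (hw : C.equi w) :
    (C.diag ⦋1⦌).equi (constToArrow w hw) := by
  intro i
  fin_cases i
  exacts [C.equi.id_mem _, hw]

lemma equi_arrowToConst {x y : C} (w : x ⟶ y) (hw : C.equi w) :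
    (C.diag ⦋1⦌).equi (arrowToConst w hw) := by
  intro i
  fin_cases i
  exacts [hw, C.equi.id_mem _]

lemma fwd_comp_bwd_eq {x : C} {F : C.diag ⦋0⦌} (f : C.constDiag ⦋0⦌ x ⟶ F)
    (hf : (C.diag ⦋0⦌).equi f) :
    (Reduced.fwd f).comp (Reduced.bwd f hf) =
      hammockFwd (f.hom.app 0) ≫ hammockBwd (f.hom.app 0) (hf 0) := by
  obtain ⟨y, rfl⟩ := Strings.exists_constDiag_eq F
  obtain ⟨g, rfl⟩ := Strings.exists_constMap_eq f
  rfl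

lemma bwd_comp_fwd_eq {y : C} {F : C.diag ⦋0⦌} (f : F ⟶ C.constDiag ⦋0⦌ y)
    (hf : (C.diag ⦋0⦌).equi f) :
    (Reduced.bwd f hf).comp (Reduced.fwd f) =
      hammockBwd (f.hom.app 0) (hf 0) ≫ hammockFwd (f.hom.app 0) := by
  obtain ⟨x, rfl⟩ := Strings.exists_constDiag_eq F
  obtain ⟨g, rfl⟩ := Strings.exists_constMap_eq f
  rfl

lemma homotopyRel_fwd_bwd {x y : C} (w : x ⟶ y) (hw : C.equi w) :
    C.homotopyRel (𝟙 ⟨x⟩) (hammockFwd w ≫ hammockBwd w hw) := by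
  refine ⟨SSet.Edge.mk (X := C.mappingSpace x x)
    ((Reduced.fwd (constToArrow w hw)).comp (Reduced.bwd _ (equi_constToArrow w hw))) ?_ ?_⟩
  · refine (fwd_comp_bwd_eq ((functor (C.diagRestrict (SimplexCategory.δ 1))).map
      (constToArrow w hw)) fun _ => equi_constToArrow w hw _).trans ?_
    exact (congrArg (Reduced.comp _) (Reduced.bwd_id _)).trans
      ((Reduced.comp_nil _).trans (Reduced.fwd_id (C.constDiag ⦋0⦌ x)))
  · exact fwd_comp_bwd_eq ((functor (C.diagRestrict (SimplexCategory.δ 0))).map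
      (constToArrow w hw)) fun _ => equi_constToArrow w hw _

lemma homotopyRel_bwd_fwd {x y : C} (w : x ⟶ y) (hw : C.equi w) :
    C.homotopyRel (hammockBwd w hw ≫ hammockFwd w) (𝟙 (⟨y⟩ : C.Hammock₀)) := by
  refine ⟨SSet.Edge.mk (X := C.mappingSpace y y)
    ((Reduced.bwd _ (equi_arrowToConst w hw)).comp (Reduced.fwd (arrowToConst w hw))) ?_ ?_⟩
  · exact bwd_comp_fwd_eq ((functor (C.diagRestrict (SimplexCategory.δ 1))).map
      (arrowToConst w hw)) fun _ => equi_arrowToConst w hw _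
  · refine (bwd_comp_fwd_eq ((functor (C.diagRestrict (SimplexCategory.δ 0))).map
      (arrowToConst w hw)) fun _ => equi_arrowToConst w hw _).trans ?_
    exact (congrArg (Reduced.comp _) (Reduced.fwd_id _)).trans
      ((Reduced.comp_nil _).trans (Reduced.bwd_id (x := C.constDiag ⦋0⦌ y) _))

lemma homotopyClasses_precomp_postcomp_eq (x : C) {y z : C.Hammock₀} {c d : y ⟶ z}
    (h : C.homotopyRel c d) (T : SSet) :
    SSet.HomotopyClasses.precomp (postcomp x c) T =
      SSet.HomotopyClasses.precomp (postcomp x d) T := by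
  obtain ⟨e⟩ := h
  exact homotopyClasses_precomp_eq (postcompHomotopy x e) T

lemma homotopyClasses_precomp_precomp_eq {x y : C.Hammock₀} {c d : x ⟶ y}
    (h : C.homotopyRel c d) (z : C) (T : SSet) :
    SSet.HomotopyClasses.precomp (precomp c z) T =
      SSet.HomotopyClasses.precomp (precomp d z) T := by
  obtain ⟨e⟩ := h
  exact homotopyClasses_precomp_eq (precompHomotopy e z) T

lemma bijective_precomp_postcomp_hammockFwd (x : C) {y z : C} {w : y ⟶ z} (hw : C.equi w)
    (T : SSet) :
    Function.Bijective (SSet.HomotopyClasses.precomp (postcomp x (hammockFwd w)) T) := by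
  apply bijective_homotopyClasses_precomp (g := postcomp x (hammockBwd w hw))
  · rw [← postcomp_comp, ← homotopyClasses_precomp_postcomp_eq x (homotopyRel_fwd_bwd w hw),
      postcomp_id, homotopyClasses_precomp_id]
  · rw [← postcomp_comp, homotopyClasses_precomp_postcomp_eq x (homotopyRel_bwd_fwd w hw),
      postcomp_id, homotopyClasses_precomp_id]

lemma bijective_precomp_precomp_hammockFwd {x y : C} {w : x ⟶ y} (hw : C.equi w) (z : C)
    (T : SSet) :
    Function.Bijective (SSet.HomotopyClasses.precomp (precomp (hammockFwd w) z) T) := by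
  apply bijective_homotopyClasses_precomp (g := precomp (hammockBwd w hw) z)
  · rw [← precomp_comp, homotopyClasses_precomp_precomp_eq (homotopyRel_bwd_fwd w hw),
      precomp_id, homotopyClasses_precomp_id]
  · rw [← precomp_comp, ← homotopyClasses_precomp_precomp_eq (homotopyRel_fwd_bwd w hw),
      precomp_id, homotopyClasses_precomp_id]

/-- A coloured arrow becomes an isomorphism in `π₀ LC`. -/
def pi₀Iso {x y : C} (w : x ⟶ y) (hw : C.equi w) :
    (CategoryTheory.Quotient.functor C.homotopyRel).obj ⟨x⟩ ≅
      (CategoryTheory.Quotient.functor C.homotopyRel).obj ⟨y⟩ where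
  hom := (CategoryTheory.Quotient.functor C.homotopyRel).map (hammockFwd w)
  inv := (CategoryTheory.Quotient.functor C.homotopyRel).map (hammockBwd w hw)
  hom_inv_id := by
    rw [← CategoryTheory.Functor.map_comp, ← CategoryTheory.Functor.map_id]
    exact (CategoryTheory.Quotient.sound _ (homotopyRel_fwd_bwd w hw)).symm
  inv_hom_id := by
    rw [← CategoryTheory.Functor.map_comp, ← CategoryTheory.Functor.map_id]
    exact CategoryTheory.Quotient.sound _ (homotopyRel_bwd_fwd w hw)

end CCat

/-! ## The homotopy category of coloured categories -/

namespace CCat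

open Zigzag Simplicial

variable {C D E : CCat.{v, u}}

lemma hom_ext {φ ψ : C ⟶ D} (h : functor φ = functor ψ) : φ = ψ := by
  suffices ∀ φ ψ : LocalizerMorphism C.equi D.equi, φ.functor = ψ.functor → φ = ψ from
    this φ ψ h
  rintro ⟨F, _⟩ ⟨G, _⟩ rfl
  rfl

/-- A natural transformation with coloured components between colour-preserving functors. -/
structure ColouredTrans (φ ψ : C ⟶ D) where
  /-- the natural transformation -/
  trans : functor φ ⟶ functor ψ
  equi (x : C) : D.equi (trans.app x)

namespace ColouredTrans

variable {φ ψ : C ⟶ D} (α : ColouredTrans φ ψ)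

/-- The functor from `[1]` to the functors from `C` to `D` that is given by `α`. -/
abbrev cyl : ComposableArrows (C ⥤ D) 1 := ComposableArrows.mk₁ α.trans

lemma equi_cyl_map_app {i j : Fin 2} (f : i ⟶ j) (x : C) : D.equi ((α.cyl.map f).app x) := by
  fin_cases i <;> fin_cases j
  exacts [D.equi.id_mem _, α.equi x, (leOfHom f).not_gt Fin.zero_lt_one |>.elim, D.equi.id_mem _]

lemma cyl_map_app_comp {i j k : Fin 2} (f : i ⟶ j) (g : j ⟶ k) (h : i ⟶ k) (x : C) :
    (α.cyl.map f).app x ≫ (α.cyl.map g).app x = (α.cyl.map h).app x := by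
  rw [← NatTrans.comp_app, ← CategoryTheory.Functor.map_comp, Subsingleton.elim (f ≫ g) h]

/-- The source of `α` for `i = 0` and its target for `i = 1`. -/
abbrev functorAt (i : Fin 2) : C ⟶ D where
  functor := α.cyl.obj i
  map _ _ _ hf := by
    fin_cases i
    exacts [functor_map_equi φ hf, functor_map_equi ψ hf]

/-- The functor on strings of `n` arrows that applies to the `i`-th object of a string the source
or the target of `α`, according to the value at `i` of `k : [n] → [1]`. -/
def mixDiag {n : SimplexCategory} (k : n ⟶ ⦋1⦌) : C.diag n ⟶ D.diag n where
  functor :=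
    { obj := fun F : C.Strings n =>
        (⟨Functor.prod' k.toOrderHom.monotone.functor F.obj ⋙ Functor.uncurry.obj α.cyl,
          fun _ _ f => D.equi.comp_mem _ _ (α.equi_cyl_map_app _ _)
            (functor_map_equi (α.functorAt _) (F.property f))⟩ : D.Strings n)
      map := fun {F G} β => ⟨
        { app := fun i => (α.cyl.obj (k.toOrderHom i)).map (β.hom.app i)
          naturality := fun i j f => by
            simp [← CategoryTheory.Functor.map_comp, β.hom.naturality] }⟩
      map_id := fun F => Strings.hom_ext fun i => CategoryTheory.Functor.map_id _ _
      map_comp := fun β γ => Strings.hom_ext fun i => CategoryTheory.Functor.map_comp _ _ _ }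
  map _ _ _ hβ i := functor_map_equi (α.functorAt _) (hβ i)

lemma mixDiag_const (n : SimplexCategory) (i : Fin 2) :
    α.mixDiag (SimplexCategory.const n ⦋1⦌ i) = diagMap (α.functorAt i) n := by
  have hobj (F : C.diag n) : (functor (α.mixDiag (SimplexCategory.const n ⦋1⦌ i))).obj F =
      (functor (diagMap (α.functorAt i) n)).obj F := by
    refine ObjectProperty.FullSubcategory.ext (CategoryTheory.Functor.hext (fun _ => rfl) ?_)
    intro a b f
    refine heq_of_eq ((congrArg (· ≫ _) ?_).trans (Category.id_comp _))
    exact congrArg (fun t => t.app (F.obj.obj a)) (α.cyl.map_id i)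
  exact hom_ext (CategoryTheory.Functor.hext hobj fun F G β =>
    Strings.hom_hext (hobj F) (hobj G) fun _ => HEq.rfl)

lemma mixDiag_obj_const_map {n : SimplexCategory} (k : n ⟶ ⦋1⦌) (x : C) {i j : Fin (n.len + 1)}
    (f : i ⟶ j) : ((functor (α.mixDiag k)).obj (C.constDiag n x)).obj.map f =
      (α.cyl.map (k.toOrderHom.monotone.functor.map f)).app x :=
  (congrArg (_ ≫ ·) ((α.cyl.obj _).map_id x)).trans (Category.comp_id _)

/-- The transformation from the constant string on `φ x` whose components are those of `α` where
`k` has value `1`. -/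
def toMix {n : SimplexCategory} (k : n ⟶ ⦋1⦌) (x : C) :
    D.constDiag n ((functor φ).obj x) ⟶ (functor (α.mixDiag k)).obj (C.constDiag n x) :=
  ⟨{ app i := (α.cyl.map (homOfLE (Fin.zero_le (k.toOrderHom i)))).app x
     naturality i j f := by
       rw [mixDiag_obj_const_map]
       exact (Category.id_comp _).trans (α.cyl_map_app_comp _ _ _ x).symm }⟩

/-- The transformation to the constant string on `ψ x` whose components are those of `α` where
`k` has value `0`. -/
def fromMix {n : SimplexCategory} (k : n ⟶ ⦋1⦌) (x : C) :
    (functor (α.mixDiag k)).obj (C.constDiag n x) ⟶ D.constDiag n ((functor ψ).obj x) :=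
  ⟨{ app i := (α.cyl.map (homOfLE (Fin.le_last (k.toOrderHom i)))).app x
     naturality i j f := by
       rw [mixDiag_obj_const_map]
       exact (α.cyl_map_app_comp _ _ _ x).trans (Category.comp_id _).symm }⟩

/-- The image of `h` under the functors `φ` and `ψ` mixed according to `k`, completed by the
components of `α` to a hammock from `φ x` to `ψ y`. -/
def mix {n : SimplexCategory} (k : n ⟶ ⦋1⦌) {x y : C} (h : (C.mappingSpace x y).obj (op n)) :
    (D.mappingSpace ((functor φ).obj x) ((functor ψ).obj y)).obj (op n) :=
  (Reduced.fwd (α.toMix k x)).comp ((Reduced.map (α.mixDiag k) h).comp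
    (Reduced.fwd (α.fromMix k y)))

lemma map_mix {m n : SimplexCategory} (θ : m ⟶ n) (k : n ⟶ ⦋1⦌) {x y : C}
    (h : (C.mappingSpace x y).obj (op n)) :
    (D.mappingSpace _ _).map θ.op (α.mix k h) =
      α.mix (θ ≫ k) ((C.mappingSpace x y).map θ.op h) := by
  have hmid : Reduced.map (D.diagRestrict θ) (Reduced.map (α.mixDiag k) h) =
      Reduced.map (α.mixDiag (θ ≫ k)) (Reduced.map (C.diagRestrict θ) h) :=
    (Reduced.map_map _ _ h).trans
      (Reduced.map_map (C.diagRestrict θ) (α.mixDiag (θ ≫ k)) h).symm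
  refine (Reduced.map_comp (D.diagRestrict θ) _ _).trans (congrArg (Reduced.comp _) ?_)
  exact (Reduced.map_comp (D.diagRestrict θ) _ _).trans (congrArg (Reduced.comp · _) hmid)

lemma mix_const (n : SimplexCategory) (i : Fin 2) {x y : C}
    (h : (C.mappingSpace x y).obj (op n)) :
    α.mix (SimplexCategory.const n ⦋1⦌ i) h =
      (Reduced.fwd (constMap n ((α.cyl.map (homOfLE (Fin.zero_le i))).app x))).comp
        (((mappingSpaceMap (α.functorAt i) x y).app _ h).comp
          (Reduced.fwd (constMap n ((α.cyl.map (homOfLE (Fin.le_last i))).app y)))) := by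
  have hobj (z : C) : (functor (α.mixDiag (SimplexCategory.const n ⦋1⦌ i))).obj
      (C.constDiag n z) = D.constDiag n ((functor (α.functorAt i)).obj z) := by
    rw [mixDiag_const, diagMap_obj_const]
  refine Reduced.fwd_comp_comp_fwd_congr (hobj x) (hobj y)
    (Strings.hom_hext rfl (hobj x) fun _ => HEq.rfl) ?_
    (Strings.hom_hext (hobj y) rfl fun _ => HEq.rfl)
  refine (congrArg _ (Reduced.map_congr (α.mixDiag_const n i) h)).trans ?_
  exact Reduced.cast_cast _ _ _ _ _

/-- The components of `α` make the two maps that `φ` and `ψ` induce into the mapping space from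
`φ x` to `ψ y` homotopic. -/
def homotopy (x y : C) :
    SSet.Homotopy
      (mappingSpaceMap φ x y ≫ postcomp ((functor φ).obj x) (hammockFwd (α.trans.app y)))
      (mappingSpaceMap ψ x y ≫ precomp (hammockFwd (α.trans.app x)) ((functor ψ).obj y)) :=
  homotopyOfOperations (fun _ k h => α.mix k h)
    (fun θ k h => α.map_mix θ k h)
    (fun n h => (α.mix_const n 0 h).trans ((congrArg (fun t => Reduced.comp t _)
      (Reduced.fwd_id _)).trans (Reduced.nil_comp _)))
    (fun n h => (α.mix_const n 1 h).trans (congrArg (Reduced.comp _) ((congrArg (Reduced.comp _)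
      (Reduced.fwd_id _)).trans (Reduced.comp_nil _))))

lemma bijective_iff (α : ColouredTrans φ ψ) (x y : C) (T : SSet) :
    Function.Bijective (SSet.HomotopyClasses.precomp (mappingSpaceMap φ x y) T) ↔
      Function.Bijective (SSet.HomotopyClasses.precomp (mappingSpaceMap ψ x y) T) := by
  have h := homotopyClasses_precomp_eq (α.homotopy x y) T
  rw [homotopyClasses_precomp_comp, homotopyClasses_precomp_comp] at h
  rw [← Function.Bijective.of_comp_iff _ (bijective_precomp_postcomp_hammockFwd _ (α.equi y) T), h,
    Function.Bijective.of_comp_iff _ (bijective_precomp_precomp_hammockFwd (α.equi x) _ T)]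

/-- The natural isomorphism of functors on `π₀ LC` given by the components of `α`. -/
def pi₀MapIso : pi₀Map φ ≅ pi₀Map ψ :=
  NatIso.ofComponents (fun X => pi₀Iso (α.trans.app X.as.as) (α.equi X.as.as)) (by
    rintro X Y ⟨f⟩
    refine CategoryTheory.Quotient.sound D.homotopyRel ?_
    exact homotopy_π₀Rel (α.homotopy X.as.as Y.as.as) f)

end ColouredTrans

lemma mappingSpaceMap_id (x y : C) : mappingSpaceMap (𝟙 C) x y = 𝟙 _ := by
  ext n h
  obtain ⟨h⟩ := h
  exact congrArg (Quot.mk _) (Zigzag.map_id h)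

lemma mappingSpaceMap_comp (φ : C ⟶ D) (ψ : D ⟶ E) (x y : C) :
    mappingSpaceMap (φ ≫ ψ) x y =
      mappingSpaceMap φ x y ≫ mappingSpaceMap ψ ((functor φ).obj x) ((functor φ).obj y) := by
  ext n h
  have hmap := Reduced.map_map (diagMap φ n.unop) (diagMap ψ n.unop) h
  have hcast := Reduced.map_cast (diagMap ψ n.unop) (diagMap_obj_const φ n.unop x)
    (diagMap_obj_const φ n.unop y) (Reduced.map (diagMap φ n.unop) h)
  refine Eq.trans ?_ (congrArg (Reduced.cast _ _) hcast).symm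
  refine Eq.trans ?_ (Reduced.cast_cast _ _ _ _ _).symm
  exact congrArg (Reduced.cast _ _) hmap.symm

lemma hammock₀Map_id (C : CCat.{v, u}) : hammock₀Map (𝟙 C) = 𝟭 _ :=
  CategoryTheory.Functor.hext (fun _ => rfl) fun x y h =>
    heq_of_eq (congrArg (fun t : C.mappingSpace _ _ ⟶ _ => t.app (op ⦋0⦌) h)
      (mappingSpaceMap_id x.as y.as))

lemma hammock₀Map_comp (φ : C ⟶ D) (ψ : D ⟶ E) :
    hammock₀Map (φ ≫ ψ) = hammock₀Map φ ⋙ hammock₀Map ψ :=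
  CategoryTheory.Functor.hext (fun _ => rfl) fun x y h =>
    heq_of_eq (congrArg (fun t : C.mappingSpace _ _ ⟶ _ => t.app (op ⦋0⦌) h)
      (mappingSpaceMap_comp φ ψ x.as y.as))

lemma pi₀Map_id (C : CCat.{v, u}) : pi₀Map (𝟙 C) = 𝟭 _ := by
  refine CategoryTheory.Quotient.lift_unique' _ _ _ ?_
  exact congrArg (· ⋙ CategoryTheory.Quotient.functor C.homotopyRel) (hammock₀Map_id C)

lemma pi₀Map_comp (φ : C ⟶ D) (ψ : D ⟶ E) : pi₀Map (φ ≫ ψ) = pi₀Map φ ⋙ pi₀Map ψ := by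
  refine CategoryTheory.Quotient.lift_unique' _ _ _ ?_
  exact congrArg (· ⋙ CategoryTheory.Quotient.functor E.homotopyRel) (hammock₀Map_comp φ ψ)

/-- The homotopy relation on colour-preserving functors, generated by the coloured natural
transformations. -/
def homotopic : HomRel CCat.{v, u} := fun _ _ φ ψ =>
  Relation.EqvGen (fun φ ψ => Nonempty (ColouredTrans φ ψ)) φ ψ

instance : Congruence homotopic.{v, u} where
  equivalence := Relation.EqvGen.is_equivalence _
  comp_left {C D E} φ {ψ ψ'} h := by
    induction h with
    | rel _ _ h =>
      obtain ⟨α⟩ := h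
      exact .rel _ _ ⟨⟨Functor.whiskerLeft (functor φ) α.trans, fun x => α.equi _⟩⟩
    | refl _ => exact .refl _
    | symm _ _ _ h => exact .symm _ _ h
    | trans _ _ _ _ _ h h' => exact .trans _ _ _ h h'
  comp_right {C D E} φ {ψ ψ'} h := by
    induction h with
    | rel _ _ h =>
      obtain ⟨α⟩ := h
      exact .rel _ _ ⟨⟨Functor.whiskerRight α.trans (functor ψ'), fun x =>
        functor_map_equi ψ' (α.equi x)⟩⟩
    | refl _ => exact .refl _
    | symm _ _ _ h => exact .symm _ _ h
    | trans _ _ _ _ _ h h' => exact .trans _ _ _ h h'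

lemma homotopic.nonempty_pi₀MapIso {φ ψ : C ⟶ D} (h : homotopic φ ψ) :
    Nonempty (pi₀Map φ ≅ pi₀Map ψ) := by
  induction h with
  | rel _ _ h => exact h.map ColouredTrans.pi₀MapIso
  | refl _ => exact ⟨Iso.refl _⟩
  | symm _ _ _ h => exact h.map Iso.symm
  | trans _ _ _ _ _ h h' =>
    obtain ⟨h⟩ := h
    exact h'.map (h.trans ·)

lemma homotopic.bijective_iff {φ ψ : C ⟶ D} (h : homotopic φ ψ) (x y : C) (T : SSet) :
    Function.Bijective (SSet.HomotopyClasses.precomp (mappingSpaceMap φ x y) T) ↔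
      Function.Bijective (SSet.HomotopyClasses.precomp (mappingSpaceMap ψ x y) T) := by
  induction h with
  | rel _ _ h =>
    obtain ⟨α⟩ := h
    exact α.bijective_iff x y T
  | refl _ => exact Iff.rfl
  | symm _ _ _ h => exact h.symm
  | trans _ _ _ _ _ h h' => exact h.trans h'

lemma homotopic.bijective_precomp_comp {φ : C ⟶ D} {ψ : D ⟶ C} (h : homotopic (φ ≫ ψ) (𝟙 C))
    (x y : C) (T : SSet) :
    Function.Bijective (SSet.HomotopyClasses.precomp (mappingSpaceMap φ x y) T ∘
      SSet.HomotopyClasses.precomp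
        (mappingSpaceMap ψ ((functor φ).obj x) ((functor φ).obj y)) T) := by
  have hid : SSet.HomotopyClasses.precomp (mappingSpaceMap (𝟙 C) x y) T = id :=
    (congrArg (fun t => SSet.HomotopyClasses.precomp t T) (mappingSpaceMap_id x y)).trans
      (homotopyClasses_precomp_id _ T)
  have hcomp := (congrArg (fun t => SSet.HomotopyClasses.precomp t T)
    (mappingSpaceMap_comp φ ψ x y)).trans (homotopyClasses_precomp_comp _ _ T)
  exact hcomp ▸ (h.bijective_iff x y T).mpr (hid.symm ▸ Function.bijective_id)

lemma equifunctors_of_homotopic {φ : C ⟶ D} {ψ : D ⟶ C} (h₁ : homotopic (φ ≫ ψ) (𝟙 C))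
    (h₂ : homotopic (ψ ≫ φ) (𝟙 D)) : equifunctors φ := by
  refine ⟨?_, fun x y T _ => ?_⟩
  · obtain ⟨e₁⟩ := h₁.nonempty_pi₀MapIso
    obtain ⟨e₂⟩ := h₂.nonempty_pi₀MapIso
    rw [pi₀Map_comp, pi₀Map_id] at e₁ e₂
    exact Functor.IsEquivalence.mk' (pi₀Map ψ) e₁.symm e₂
  · have b₁ := h₁.bijective_precomp_comp x y T
    have b₂ := h₂.bijective_precomp_comp ((functor φ).obj x) ((functor φ).obj y) T
    exact (Function.Bijective.of_comp_iff _ ⟨b₁.injective.of_comp, b₂.surjective.of_comp⟩).mp b₁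

/-- The functor from coloured categories to their homotopy category. -/
abbrev toHo : CCat.{v, u} ⥤ CategoryTheory.Quotient homotopic.{v, u} :=
  CategoryTheory.Quotient.functor _

lemma toHo_map_eq {φ ψ : C ⟶ D} (α : ColouredTrans φ ψ) : toHo.map φ = toHo.map ψ :=
  CategoryTheory.Quotient.sound _ (.rel _ _ ⟨α⟩)

lemma equifunctors_of_isIso_toHo_map (φ : C ⟶ D) [IsIso (toHo.map φ)] : equifunctors φ := by
  obtain ⟨ψ, hψ⟩ := toHo.map_surjective (inv (toHo.map φ))
  refine equifunctors_of_homotopic (ψ := ψ) ?_ ?_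
  · refine (CategoryTheory.Quotient.functor_map_eq_iff homotopic (φ ≫ ψ) (𝟙 C)).mp ?_
    rw [CategoryTheory.Functor.map_comp, hψ, IsIso.hom_inv_id, CategoryTheory.Functor.map_id]
  · refine (CategoryTheory.Quotient.functor_map_eq_iff homotopic (ψ ≫ φ) (𝟙 D)).mp ?_
    rw [CategoryTheory.Functor.map_comp, hψ, IsIso.inv_hom_id, CategoryTheory.Functor.map_id]

end CCat

/-! ## Tensor products of cofibrant objects -/

namespace MonoidalModelCategory

section Tensor

variable {M : Type u} [Category.{v} M] [MonoidalCategory M] [ModelCategory M]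
  [MonoidalModelCategory M]

attribute [local instance] closed_left closed_right

lemma nonempty_isInitial_tensor_initial (X : M) : Nonempty (IsInitial (X ⊗ ⊥_ M)) :=
  ⟨initialIsInitial.isInitialObj (tensorLeft X) _⟩

lemma nonempty_isInitial_initial_tensor (X : M) : Nonempty (IsInitial ((⊥_ M) ⊗ X)) :=
  ⟨initialIsInitial.isInitialObj (tensorRight X) _⟩

lemma isIso_initial_whiskerLeft {Y Y' : M} (i : Y ⟶ Y') : IsIso ((⊥_ M) ◁ i) :=
  isIso_of_isInitial (nonempty_isInitial_initial_tensor Y).some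
    (nonempty_isInitial_initial_tensor Y').some _

lemma isIso_whiskerRight_initial {Y Y' : M} (i : Y ⟶ Y') : IsIso (i ▷ (⊥_ M)) :=
  isIso_of_isInitial (nonempty_isInitial_tensor_initial Y).some
    (nonempty_isInitial_tensor_initial Y').some _

lemma nonempty_whiskerLeft_iso_pushoutProduct (X : M) {Y Y' : M} (i : Y ⟶ Y') :
    Nonempty (Arrow.mk (X ◁ i) ≅
      (Arrow.pushoutProduct.obj (Arrow.mk (initial.to X))).obj (Arrow.mk i)) := by
  let sq := Functor.PushoutObjObj.ofHasPushout (curriedTensor M) (initial.to X) i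
  have : IsIso (((curriedTensor M).obj (⊥_ M)).map i) := isIso_initial_whiskerLeft i
  have h : IsIso sq.inl := sq.isPushout.isIso_inl_of_isIso
  exact ⟨Arrow.isoMk (@asIso _ _ _ _ sq.inl h) (Iso.refl _)
    (sq.inl_ι.trans (Category.comp_id _).symm)⟩

lemma nonempty_whiskerRight_iso_pushoutProduct {Y Y' : M} (i : Y ⟶ Y') (X : M) :
    Nonempty (Arrow.mk (i ▷ X) ≅
      (Arrow.pushoutProduct.obj (Arrow.mk i)).obj (Arrow.mk (initial.to X))) := by
  let sq := Functor.PushoutObjObj.ofHasPushout (curriedTensor M) i (initial.to X)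
  have : IsIso (((curriedTensor M).map i).app (⊥_ M)) := isIso_whiskerRight_initial i
  have h : IsIso sq.inr := sq.isPushout.isIso_inr_of_isIso
  exact ⟨Arrow.isoMk (@asIso _ _ _ _ sq.inr h) (Iso.refl _)
    (sq.inr_ι.trans (Category.comp_id _).symm)⟩

lemma cofibration_whiskerLeft (X : M) [IsCofibrant X] {Y Y' : M} (i : Y ⟶ Y') [Cofibration i] :
    Cofibration (X ◁ i) := by
  obtain ⟨e⟩ := nonempty_whiskerLeft_iso_pushoutProduct X i
  have := pushoutProduct_cofibration (Arrow.mk (initial.to X)) (Arrow.mk i) ‹_› ‹_›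
  exact ⟨((cofibrations M).arrow_iso_iff e).mpr this.mem⟩

lemma weakEquivalence_whiskerLeft_of_cofibration (X : M) [IsCofibrant X] {Y Y' : M} (i : Y ⟶ Y')
    [Cofibration i] [WeakEquivalence i] : WeakEquivalence (X ◁ i) := by
  obtain ⟨e⟩ := nonempty_whiskerLeft_iso_pushoutProduct X i
  have := pushoutProduct_weakEquivalence (Arrow.mk (initial.to X)) (Arrow.mk i) ‹_› ‹_› (.inr ‹_›)
  exact ⟨((weakEquivalences M).arrow_iso_iff e).mpr this.mem⟩

lemma weakEquivalence_whiskerRight_of_cofibration {Y Y' : M} (i : Y ⟶ Y')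
    [Cofibration i] [WeakEquivalence i] (X : M) [IsCofibrant X] : WeakEquivalence (i ▷ X) := by
  obtain ⟨e⟩ := nonempty_whiskerRight_iso_pushoutProduct i X
  have := pushoutProduct_weakEquivalence (Arrow.mk i) (Arrow.mk (initial.to X)) ‹_› ‹_› (.inl ‹_›)
  exact ⟨((weakEquivalences M).arrow_iso_iff e).mpr this.mem⟩

lemma isCofibrant_tensor (X Y : M) [IsCofibrant X] [IsCofibrant Y] : IsCofibrant (X ⊗ Y) :=
  (isCofibrant_iff_of_isInitial (X ◁ initial.to Y)
    (nonempty_isInitial_tensor_initial X).some).mpr (cofibration_whiskerLeft X (initial.to Y))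

/-- Ken Brown's lemma. -/
lemma weakEquivalence_map_of_isCofibrant {C D : Type*} [Category* C] [Category* D] [ModelCategory C]
    [ModelCategory D] (F : C ⥤ D)
    (hF : ∀ ⦃X Y : C⦄ (i : X ⟶ Y) [Cofibration i] [WeakEquivalence i], WeakEquivalence (F.map i))
    {X Y : C} (f : X ⟶ Y) [IsCofibrant X] [IsCofibrant Y] [WeakEquivalence f] :
    WeakEquivalence (F.map f) := by
  obtain ⟨h⟩ : Nonempty (CofibrantBrownFactorization f) := inferInstance
  have hi := hF h.i
  have hs := hF h.s
  have hp : WeakEquivalence (F.map h.p) := by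
    have : F.map h.s ≫ F.map h.p = 𝟙 _ := by rw [← F.map_comp, h.s_p, F.map_id]
    exact weakEquivalence_of_precomp_of_fac this
  rw [← h.fac, F.map_comp]
  infer_instance

lemma weakEquivalence_whiskerLeft (X : M) [IsCofibrant X] {Y Y' : M} (f : Y ⟶ Y') [IsCofibrant Y]
    [IsCofibrant Y'] [WeakEquivalence f] : WeakEquivalence (X ◁ f) :=
  weakEquivalence_map_of_isCofibrant (tensorLeft X)
    (fun _ _ i _ _ => weakEquivalence_whiskerLeft_of_cofibration X i) f

lemma weakEquivalence_whiskerRight {Y Y' : M} (f : Y ⟶ Y') [IsCofibrant Y]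
    [IsCofibrant Y'] [WeakEquivalence f] (X : M) [IsCofibrant X] : WeakEquivalence (f ▷ X) :=
  weakEquivalence_map_of_isCofibrant (tensorRight X)
    (fun _ _ i _ _ => weakEquivalence_whiskerRight_of_cofibration i X) f

lemma weakEquivalence_tensorHom {X X' Y Y' : M} (f : X ⟶ X') (g : Y ⟶ Y') [IsCofibrant X]
    [IsCofibrant X'] [IsCofibrant Y] [IsCofibrant Y'] [WeakEquivalence f] [WeakEquivalence g] :
    WeakEquivalence (f ⊗ₘ g) := by
  have := weakEquivalence_whiskerRight f Y
  have := weakEquivalence_whiskerLeft X' g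
  rw [MonoidalCategory.tensorHom_def]
  infer_instance

lemma weakEquivalence_tensorHom_leftUnitor_hom {X Y : M} (f : X ⟶ 𝟙_ M) (g : Y ⟶ 𝟙_ M)
    [IsCofibrant X] [IsCofibrant Y] [WeakEquivalence f] [WeakEquivalence g] :
    WeakEquivalence ((f ⊗ₘ g) ≫ (λ_ (𝟙_ M)).hom) := by
  have := unit_left f Y ‹_› ‹_› ‹_›
  rw [MonoidalCategory.tensorHom_def, assoc, leftUnitor_naturality, ← assoc]
  infer_instance

end Tensor

section Replacement

variable {M : Type u} [Category.{v} M] [ModelCategory M]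
  (data : MorphismProperty.FunctorialFactorizationData (cofibrations M) (trivialFibrations M))
  {B : M} (z : Over B)

/-- The functorial replacement of an object `w` over `B` by an object that is weakly equivalent to
`B` and receives maps from both `w` and `z`. -/
def replacement : Over B ⥤ Over B where
  obj w := Over.mk (data.factorizationData (coprod.desc w.hom z.hom)).p
  map {w w'} f := Over.homMk (data.mapZ (Arrow.homMk (coprod.map f.left (𝟙 _)) (𝟙 B) (by simp)))
    ((data.mapZ_p _).trans (Category.comp_id _))
  map_id w := by
    ext
    refine Eq.trans ?_ (data.mapZ_id (coprod.desc w.hom z.hom))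
    exact congrArg data.mapZ (Arrow.hom_ext _ _ (by simp) rfl)
  map_comp f g := by
    ext
    refine Eq.trans ?_ (data.mapZ_comp _ _)
    exact congrArg data.mapZ (Arrow.hom_ext _ _ (by simp) (by simp))

/-- The map from an object over `B` to its replacement. -/
def toReplacement : 𝟭 (Over B) ⟶ replacement data z where
  app w := Over.homMk (coprod.inl ≫ (data.factorizationData (coprod.desc w.hom z.hom)).i) (by
    change (_ ≫ _) ≫ (data.factorizationData (coprod.desc w.hom z.hom)).p = _
    rw [assoc, MorphismProperty.MapFactorizationData.fac]
    exact coprod.inl_desc _ _)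
  naturality w w' f := by
    ext
    change f.left ≫ coprod.inl ≫ _ = (coprod.inl ≫ _) ≫ data.mapZ _
    rw [assoc, data.i_mapZ]
    simp

/-- The map from `z` to the replacement of an object over `B`. -/
def constToReplacement : (Functor.const (Over B)).obj z ⟶ replacement data z where
  app w := Over.homMk (coprod.inr ≫ (data.factorizationData (coprod.desc w.hom z.hom)).i) (by
    change (_ ≫ _) ≫ (data.factorizationData (coprod.desc w.hom z.hom)).p = _
    rw [assoc, MorphismProperty.MapFactorizationData.fac]
    exact coprod.inr_desc _ _)
  naturality w w' f := by
    ext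
    change 𝟙 _ ≫ coprod.inr ≫ _ = (coprod.inr ≫ _) ≫ data.mapZ _
    rw [assoc, data.i_mapZ]
    simp

lemma isCofibrant_replacement_obj_left (w : Over B) [IsCofibrant w.left] [IsCofibrant z.left] :
    IsCofibrant ((replacement data z).obj w).left := by
  let i : w.left ⨿ z.left ⟶ ((replacement data z).obj w).left :=
    (data.factorizationData (coprod.desc w.hom z.hom)).i
  have : Cofibration i := ⟨(data.factorizationData (coprod.desc w.hom z.hom)).hi⟩
  have : IsCofibrant (w.left ⨿ z.left) := isCofibrant_of_cofibration (coprod.inl : w.left ⟶ _)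
  exact isCofibrant_of_cofibration i

lemma weakEquivalence_replacement_obj_hom (w : Over B) :
    WeakEquivalence ((replacement data z).obj w).hom :=
  inferInstanceAs (WeakEquivalence (data.factorizationData (coprod.desc w.hom z.hom)).p)

end Replacement

end MonoidalModelCategory

/-! ## Multiplicative families indexed by the arrows of an ordinal -/

section ArrowProduct

variable {n : ℕ}

/-- Recursion on the arrows of the ordinal `0 < ⋯ < n`: every arrow is an edge or is obtained from
a shorter arrow by adding an edge at its end. -/
@[elab_as_elim]
def arrowRec {motive : ∀ a b : Fin (n + 1), a < b → Sort*}
    (edge : ∀ j : Fin n, motive j.castSucc j.succ j.castSucc_lt_succ)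
    (step : ∀ (a : Fin (n + 1)) (j : Fin n) (h : a < j.castSucc),
      motive a j.castSucc h → motive a j.succ (h.trans j.castSucc_lt_succ))
    (a b : Fin (n + 1)) (hab : a < b) : motive a b hab :=
  Fin.induction (motive := fun b => ∀ a hab, motive a b hab)
    (fun a h => absurd h (Fin.not_lt_zero a))
    (fun j ih a h => if ha : a = j.castSucc then by subst ha; exact edge j else
      step a j (lt_of_le_of_ne (Fin.le_castSucc_iff.mpr h) ha) (ih a _)) b a hab

section

variable {motive : ∀ a b : Fin (n + 1), a < b → Sort*}
  (edge : ∀ j : Fin n, motive j.castSucc j.succ j.castSucc_lt_succ)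
  (step : ∀ (a : Fin (n + 1)) (j : Fin n) (h : a < j.castSucc),
    motive a j.castSucc h → motive a j.succ (h.trans j.castSucc_lt_succ))

lemma arrowRec_edge (j : Fin n) :
    arrowRec (motive := motive) edge step _ _ j.castSucc_lt_succ = edge j := by
  simp [arrowRec, Fin.induction_succ]

lemma arrowRec_step (a : Fin (n + 1)) (j : Fin n) (h : a < j.castSucc) :
    arrowRec (motive := motive) edge step a j.succ (h.trans j.castSucc_lt_succ) =
      step a j h (arrowRec edge step a j.castSucc h) := by
  simp [arrowRec, Fin.induction_succ, h.ne]

end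

/-- An associative product on a family of types indexed by the arrows of the ordinal
`0 < ⋯ < n`. -/
structure ArrowProduct (X : ∀ a b : Fin (n + 1), a < b → Type*) where
  /-- the product -/
  mul {a b c : Fin (n + 1)} (hab : a < b) (hbc : b < c) :
    X a b hab → X b c hbc → X a c (hab.trans hbc)
  mul_assoc {a b c d : Fin (n + 1)} (hab : a < b) (hbc : b < c) (hcd : c < d)
    (x : X a b hab) (y : X b c hbc) (z : X c d hcd) :
    mul (hab.trans hbc) hcd (mul hab hbc x y) z = mul hab (hbc.trans hcd) x (mul hbc hcd y z)

namespace ArrowProduct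

variable {X : ∀ a b : Fin (n + 1), a < b → Type*} (m : ArrowProduct X)

/-- The families of elements that send composites to products. -/
def IsMultiplicative (s : ∀ a b hab, X a b hab) : Prop :=
  ∀ a b c (hab : a < b) (hbc : b < c), s a c (hab.trans hbc) = m.mul hab hbc (s a b hab) (s b c hbc)

lemma exists_isMultiplicative (e : ∀ j : Fin n, X j.castSucc j.succ j.castSucc_lt_succ) :
    ∃ s, m.IsMultiplicative s ∧ ∀ j, s _ _ j.castSucc_lt_succ = e j := by
  obtain ⟨s, s_edge, s_step⟩ : ∃ s : ∀ a b hab, X a b hab, (∀ j, s _ _ j.castSucc_lt_succ = e j) ∧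
      ∀ a (j : Fin n) (h : a < j.castSucc), s a j.succ (h.trans j.castSucc_lt_succ) =
        m.mul h j.castSucc_lt_succ (s a j.castSucc h) (e j) :=
    ⟨arrowRec e fun a j h x => m.mul h j.castSucc_lt_succ x (e j), arrowRec_edge _ _,
      arrowRec_step _ _⟩
  refine ⟨s, fun a b c hab hbc => ?_, s_edge⟩
  induction b, c, hbc using arrowRec with
  | edge j => rw [s_step, s_edge]
  | step b j hb ih => rw [s_step a j (hab.trans hb), s_step, ih, m.mul_assoc]

variable {m}

lemma IsMultiplicative.forall_of_edge {s : ∀ a b hab, X a b hab} (hs : m.IsMultiplicative s)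
    {P : ∀ {a b hab}, X a b hab → Prop}
    (mul : ∀ {a b c} (hab : a < b) (hbc : b < c) {x : X a b hab} {y : X b c hbc},
      P x → P y → P (m.mul hab hbc x y))
    (edge : ∀ j : Fin n, P (s _ _ j.castSucc_lt_succ)) (a b : Fin (n + 1)) (hab : a < b) :
    P (s a b hab) := by
  induction a, b, hab using arrowRec with
  | edge j => exact edge j
  | step a j h ih => exact hs a _ _ h j.castSucc_lt_succ ▸ mul h j.castSucc_lt_succ ih (edge j)

lemma IsMultiplicative.ext {s t : ∀ a b hab, X a b hab} (hs : m.IsMultiplicative s)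
    (ht : m.IsMultiplicative t)
    (h : ∀ j : Fin n, s _ _ j.castSucc_lt_succ = t _ _ j.castSucc_lt_succ) : s = t := by
  funext a b hab
  induction a, b, hab using arrowRec with
  | edge j => exact h j
  | step a j ha ih =>
    rw [hs a _ _ ha j.castSucc_lt_succ, ht a _ _ ha j.castSucc_lt_succ, ih, h]

end ArrowProduct

end ArrowProduct

/-! ## The coloured arrows of a semi-ordinal -/

namespace FatDelta

variable {K L : FatDelta}

lemma Equi.split {a b c : Fin (K.edges + 1)} (hab : a < b) (hbc : b < c) (h : K.Equi a c) :
    K.Equi a b ∧ K.Equi b c :=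
  ⟨fun j h₁ h₂ => h j h₁ (h₂.trans hbc.le), fun j h₁ h₂ => h j (hab.le.trans h₁) h₂⟩

lemma Equi.trans {a b c : Fin (K.edges + 1)} (h : K.Equi a b) (h' : K.Equi b c) :
    K.Equi a c := by
  intro j h₁ h₂
  rcases lt_or_ge j.castSucc b with hb | hb
  · exact h j h₁ (Fin.castSucc_lt_iff_succ_le.mp hb)
  · exact h' j hb h₂

lemma equi_edge (K : FatDelta) (j : Fin K.edges) :
    K.Equi j.castSucc j.succ ↔ K.linked j = true := by
  refine ⟨fun h => h j le_rfl le_rfl, fun h i h₁ h₂ => ?_⟩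
  obtain rfl : i = j :=
    le_antisymm (Fin.succ_le_succ_iff.mp h₂) (Fin.castSucc_le_castSucc_iff.mp h₁)
  exact h

lemma hom_ext {f g : K ⟶ L} (h : ∀ a, f.toFun a = g.toFun a) : f = g := Hom.ext (funext h)

/-- The arrow of the fat delta given by a map on vertices that is increasing and preserves the
colours on the edges. -/
def homOfEdges (f : Fin (K.edges + 1) → Fin (L.edges + 1))
    (hf : ∀ j : Fin K.edges, f j.castSucc < f j.succ)
    (h : ∀ j : Fin K.edges, K.linked j = true → L.Equi (f j.castSucc) (f j.succ)) : K ⟶ L where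
  toFun := f
  strictMono := Fin.strictMono_iff_lt_succ.mpr hf
  map_equi a b hab hK := by
    induction a, b, hab using arrowRec with
    | edge j => exact h j ((K.equi_edge j).mp hK)
    | step a j ha ih =>
      have := hK.split ha j.castSucc_lt_succ
      exact (ih this.1).trans (h j ((K.equi_edge j).mp this.2))

end FatDelta

/-! ## Strictifications of the tensor product -/

/-- A semigroup `S` whose elements represent the cofibrant objects of `M`, in such a way that the
multiplication of `S` represents the tensor product. -/
structure Strictification (M : Type u) [Category.{v} M] [MonoidalCategory M] [ModelCategory M] where
  /-- the semigroup -/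
  S : Type (max u v)
  [semigroup : Semigroup S]
  /-- the object represented by an element -/
  r : S → M
  [isCofibrant : ∀ s, IsCofibrant (r s)]
  /-- the comparison of the multiplication with the tensor product -/
  μ : ∀ s t, r (s * t) ≅ r s ⊗ r t
  associativity : ∀ s t w, (μ (s * t) w).hom ≫ ((μ s t).hom ▷ r w) ≫ (α_ _ _ _).hom =
    eqToHom (congrArg r (mul_assoc s t w)) ≫ (μ s (t * w)).hom ≫ (r s ◁ (μ t w).hom)
  exists_eq : ∀ (Z : M) [IsCofibrant Z], ∃ s, r s = Z

namespace Strictification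

attribute [instance] semigroup isCofibrant

variable {M : Type u} [Category.{v} M] [MonoidalCategory M] [ModelCategory M]
  (𝓡 : Strictification M)

/-- The comparison isomorphism for an element that is equal to a product. -/
def mulIso {s t w : 𝓡.S} (h : w = s * t) : 𝓡.r w ≅ 𝓡.r s ⊗ 𝓡.r t :=
  eqToIso (congrArg 𝓡.r h) ≪≫ 𝓡.μ s t

lemma mulIso_associativity {s t w st tw stw : 𝓡.S} (h₁ : st = s * t) (h₂ : tw = t * w)
    (h₃ : stw = s * tw) (h₄ : stw = st * w) :
    (𝓡.mulIso h₃).hom ≫ (𝓡.r s ◁ (𝓡.mulIso h₂).hom) =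
      (𝓡.mulIso h₄).hom ≫ ((𝓡.mulIso h₁).hom ▷ 𝓡.r w) ≫ (α_ _ _ _).hom := by
  subst h₁ h₂ h₄
  simp [mulIso, 𝓡.associativity]

/-- An element of `S` together with, when `p` holds, a weak equivalence from the object it
represents to the unit object. For a colour `p`, these are the edges of the diagrams below. -/
structure Edge (p : Prop) where
  /-- the element -/
  obj : 𝓡.S
  /-- the weak equivalence to the unit object -/
  unit : p → (𝓡.r obj ⟶ 𝟙_ M)
  weakEquivalence_unit : ∀ h, WeakEquivalence (unit h)

namespace Edge

variable {𝓡} {p q r : Prop}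

attribute [instance] weakEquivalence_unit

lemma ext' {x y : 𝓡.Edge p} (h : x.obj = y.obj)
    (h' : ∀ hp, x.unit hp = eqToHom (congrArg 𝓡.r h) ≫ y.unit hp) : x = y := by
  obtain ⟨s, w, hw⟩ := x
  obtain ⟨s', w', hw'⟩ := y
  obtain rfl : s = s' := h
  obtain rfl : w = w' := by
    funext hp
    simpa using h' hp
  rfl

/-- The arrows between edges. -/
@[ext]
structure Hom (x y : 𝓡.Edge p) where
  /-- the underlying arrow of `M` -/
  hom : 𝓡.r x.obj ⟶ 𝓡.r y.obj
  hom_unit : ∀ h, hom ≫ y.unit h = x.unit h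

instance : Category.{v} (𝓡.Edge p) where
  Hom := Hom
  id x := ⟨𝟙 _, fun _ => by simp⟩
  comp f g := ⟨f.hom ≫ g.hom, fun h => by rw [assoc, g.hom_unit, f.hom_unit]⟩

@[ext]
lemma hom_ext {x y : 𝓡.Edge p} {f g : x ⟶ y} (h : Hom.hom f = Hom.hom g) : f = g :=
  Hom.ext h

@[simp]
lemma id_hom (x : 𝓡.Edge p) : Hom.hom (𝟙 x) = 𝟙 _ := rfl

@[simp]
lemma comp_hom {x y z : 𝓡.Edge p} (f : x ⟶ y) (g : y ⟶ z) :
    Hom.hom (f ≫ g) = Hom.hom f ≫ Hom.hom g := rfl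

/-- The functor that restricts the weak equivalences to the unit object along an implication. -/
def forget (h : q → p) : 𝓡.Edge p ⥤ 𝓡.Edge q where
  obj x := ⟨x.obj, fun hq => x.unit (h hq), fun _ => x.weakEquivalence_unit _⟩
  map f := ⟨f.hom, fun _ => f.hom_unit _⟩

variable (𝓡 p) in
/-- The edges, coloured by the weak equivalences. -/
def ccat : CCat.{v, max u v} where
  carrier := 𝓡.Edge p
  equi := fun _ _ f => WeakEquivalence (Hom.hom f)
  isMultiplicative :=
    { id_mem := fun x => inferInstanceAs (WeakEquivalence (𝟙 (𝓡.r x.obj)))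
      comp_mem := fun f g (_ : WeakEquivalence _) (_ : WeakEquivalence _) =>
        inferInstanceAs (WeakEquivalence (Hom.hom f ≫ Hom.hom g)) }

variable (𝓡) in
/-- The functor `forget`, as an arrow of coloured categories. -/
def ccatForget (h : q → p) : ccat 𝓡 p ⟶ ccat 𝓡 q :=
  { functor := forget h, map := fun _ _ _ hf => hf }

variable [MonoidalModelCategory M]

/-- The product of two edges: an edge whose colour implies the colours of both factors. -/
def mul (h : r → p ∧ q) (x : 𝓡.Edge p) (y : 𝓡.Edge q) : 𝓡.Edge r where
  obj := x.obj * y.obj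
  unit hr := (𝓡.μ x.obj y.obj).hom ≫ (x.unit (h hr).1 ⊗ₘ y.unit (h hr).2) ≫ (λ_ (𝟙_ M)).hom
  weakEquivalence_unit hr := by
    have := MonoidalModelCategory.weakEquivalence_tensorHom_leftUnitor_hom
      (x.unit (h hr).1) (y.unit (h hr).2)
    infer_instance

lemma obj_eq_of_eq_mul {h : r → p ∧ q} {x : 𝓡.Edge p} {y : 𝓡.Edge q} {z : 𝓡.Edge r}
    (e : z = mul h x y) : z.obj = x.obj * y.obj :=
  congrArg obj e

lemma unit_eq_of_eq_mul {h : r → p ∧ q} {x : 𝓡.Edge p} {y : 𝓡.Edge q} {z : 𝓡.Edge r}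
    (e : z = mul h x y) (hr : r) :
    z.unit hr = (𝓡.mulIso (obj_eq_of_eq_mul e)).hom ≫
      (x.unit (h hr).1 ⊗ₘ y.unit (h hr).2) ≫ (λ_ (𝟙_ M)).hom := by
  subst e
  rw [mulIso, Iso.trans_hom, assoc]
  exact (Category.id_comp _).symm

lemma mul_assoc' {p₁ p₂ p₃ p₁₂ p₂₃ p₁₂₃ : Prop} {h₁₂ : p₁₂ → p₁ ∧ p₂} {h : p₁₂₃ → p₁₂ ∧ p₃}
    {h₂₃ : p₂₃ → p₂ ∧ p₃} {h' : p₁₂₃ → p₁ ∧ p₂₃} (x : 𝓡.Edge p₁) (y : 𝓡.Edge p₂)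
    (z : 𝓡.Edge p₃) : mul h (mul h₁₂ x y) z = mul h' x (mul h₂₃ y z) := by
  refine ext' (_root_.mul_assoc _ _ _) fun hp => ?_
  have unit_assoc (f : 𝓡.r x.obj ⟶ 𝟙_ M) (g : 𝓡.r y.obj ⟶ 𝟙_ M) (k : 𝓡.r z.obj ⟶ 𝟙_ M) :
      (((f ⊗ₘ g) ≫ (λ_ (𝟙_ M)).hom) ⊗ₘ k) ≫ (λ_ (𝟙_ M)).hom =
        (α_ _ _ _).hom ≫ (f ⊗ₘ ((g ⊗ₘ k) ≫ (λ_ (𝟙_ M)).hom)) ≫ (λ_ (𝟙_ M)).hom := by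
    rw [← tensorHom_comp_whiskerRight, ← tensorHom_comp_whiskerLeft, unitors_equal, assoc, assoc,
      ← triangle_assoc, associator_naturality_assoc, ← unitors_equal]
  simp only [mul]
  rw [← whiskerRight_comp_tensorHom, ← whiskerLeft_comp_tensorHom, assoc, assoc, unit_assoc,
    reassoc_of% 𝓡.associativity]

end Edge

end Strictification

/-! ## Isomorphisms and products of coloured categories -/

lemma exists_inverse_of_bijective_obj {C D : Type*} [Category* C] [Category* D] (F : C ⥤ D)
    [F.Full] [F.Faithful] (hF : Function.Bijective F.obj) :
    ∃ G : D ⥤ C, F ⋙ G = 𝟭 C ∧ G ⋙ F = 𝟭 D := by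
  let e := Equiv.ofBijective F.obj hF
  have he (x : D) : F.obj (e.symm x) = x := e.apply_symm_apply x
  have he' (x : C) : e.symm (F.obj x) = x := e.symm_apply_apply x
  let G : D ⥤ C :=
    { obj := e.symm
      map := fun f => F.preimage (eqToHom (he _) ≫ f ≫ eqToHom (he _).symm)
      map_id := fun x => F.map_injective (by simp)
      map_comp := fun f g => F.map_injective (by simp) }
  exact ⟨G,
    CategoryTheory.Functor.ext he' fun x y f => F.map_injective (by simp [G, eqToHom_map]),
    CategoryTheory.Functor.ext he fun x y f => by simp [G]⟩

namespace CCat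

variable {C D : CCat.{v, u}}

lemma equi_eqToHom {x y : C} (h : x = y) : C.equi (eqToHom h) := by
  subst h
  exact C.equi.id_mem _

lemma isIso_of_bijective (φ : C ⟶ D) [(functor φ).Full] [(functor φ).Faithful]
    (hφ : Function.Bijective (functor φ).obj)
    (h : ∀ {x y : C} (f : x ⟶ y), D.equi ((functor φ).map f) → C.equi f) : IsIso φ := by
  obtain ⟨G, comp_G, G_comp⟩ := exists_inverse_of_bijective_obj (functor φ) hφ
  have equi_G {x y : D} (f : x ⟶ y) (hf : D.equi f) : C.equi (G.map f) := h _ (by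
    rw [← Functor.comp_map, Functor.congr_hom G_comp f]
    exact D.equi.comp_mem _ _ (equi_eqToHom _) (D.equi.comp_mem _ _ hf (equi_eqToHom _)))
  let ψ : D ⟶ C := { functor := G, map := fun _ _ f hf => equi_G f hf }
  exact ⟨ψ, hom_ext comp_G, hom_ext G_comp⟩

section

variable {ι : Type} (C : ι → CCat.{v, u})

/-- The product of a family of coloured categories. -/
def pi : CCat.{v, u} where
  carrier := ∀ i, C i
  equi := fun (x y : ∀ i, C i) (f : x ⟶ y) => ∀ i, (C i).equi (f i)
  isMultiplicative :=
    { id_mem := fun _ i => (C i).equi.id_mem _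
      comp_mem := fun _ _ hf hg i => (C i).equi.comp_mem _ _ (hf i) (hg i) }

/-- The projections of a product of coloured categories. -/
def piEval (i : ι) : pi C ⟶ C i :=
  { functor := Pi.eval (fun i => C i) i, map := fun _ _ _ hf => hf i }

variable {C}

/-- The arrow into a product that is given by its components. -/
def piLift (φ : ∀ i, D ⟶ C i) : D ⟶ pi C :=
  { functor := Functor.pi' fun i => functor (φ i)
    map := fun _ _ _ hf i => functor_map_equi (φ i) hf }

lemma piLift_eval (φ : ∀ i, D ⟶ C i) (i : ι) : piLift φ ≫ piEval C i = φ i := rfl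

lemma pi_hom_ext {φ ψ : D ⟶ pi C} (h : ∀ i, φ ≫ piEval C i = ψ ≫ piEval C i) : φ = ψ :=
  congrArg piLift (funext h)

end

lemma subsingleton_hom [IsDiscrete D] [Subsingleton D] : Subsingleton (C ⟶ D) :=
  ⟨fun _ _ => hom_ext (CategoryTheory.Functor.ext (fun _ => Subsingleton.elim _ _)
    (fun _ _ _ => Subsingleton.elim _ _))⟩

end CCat

/-! ## Diagrams shaped by a semi-ordinal -/

namespace Strictification

variable {M : Type u} [Category.{v} M] [MonoidalCategory M] [ModelCategory M]
  [MonoidalModelCategory M] (𝓡 : Strictification M) (K : FatDelta)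

/-- The product of the edges that lie over the arrows of `K`. -/
def edgeProduct : ArrowProduct fun a b (_ : a < b) => 𝓡.Edge (K.Equi a b) where
  mul hab hbc x y := Edge.mul (fun h => h.split hab hbc) x y
  mul_assoc _ _ _ x y z := Edge.mul_assoc' x y z

/-- A diagram of shape `K`: a multiplicative family of edges indexed by the arrows of `K`. -/
structure Diag where
  /-- the edges -/
  edge : ∀ a b : Fin (K.edges + 1), a < b → 𝓡.Edge (K.Equi a b)
  isMultiplicative : (𝓡.edgeProduct K).IsMultiplicative edge

namespace Diag

variable {𝓡} {K} {L : FatDelta}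

/-- The multiplicativity of a diagram, in `M`. -/
def mul (T : 𝓡.Diag K) {a b c : Fin (K.edges + 1)} (hab : a < b) (hbc : b < c) :
    𝓡.r (T.edge a c (hab.trans hbc)).obj ≅
      𝓡.r (T.edge a b hab).obj ⊗ 𝓡.r (T.edge b c hbc).obj :=
  𝓡.mulIso (Edge.obj_eq_of_eq_mul (h := fun h => h.split hab hbc)
    (T.isMultiplicative a b c hab hbc))

lemma mul_unit (T : 𝓡.Diag K) {a b c : Fin (K.edges + 1)} (hab : a < b) (hbc : b < c)
    (h : K.Equi a c) :
    (T.edge a c (hab.trans hbc)).unit h = (T.mul hab hbc).hom ≫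
      ((T.edge a b hab).unit (h.split hab hbc).1 ⊗ₘ
        (T.edge b c hbc).unit (h.split hab hbc).2) ≫ (λ_ (𝟙_ M)).hom :=
  Edge.unit_eq_of_eq_mul (h := fun h => h.split hab hbc) (T.isMultiplicative a b c hab hbc) h

lemma mul_associativity (T : 𝓡.Diag K) {a b c d : Fin (K.edges + 1)} (hab : a < b) (hbc : b < c)
    (hcd : c < d) :
    (T.mul hab (hbc.trans hcd)).hom ≫ (_ ◁ (T.mul hbc hcd).hom) =
      (T.mul (hab.trans hbc) hcd).hom ≫ ((T.mul hab hbc).hom ▷ _) ≫ (α_ _ _ _).hom :=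
  𝓡.mulIso_associativity _ _ _ _

/-- The product of arrows between the edges of two diagrams. -/
def homProduct (T T' : 𝓡.Diag K) :
    ArrowProduct fun a b (hab : a < b) => T.edge a b hab ⟶ T'.edge a b hab where
  mul hab hbc f g :=
    { hom := (T.mul hab hbc).hom ≫ (Edge.Hom.hom f ⊗ₘ Edge.Hom.hom g) ≫ (T'.mul hab hbc).inv
      hom_unit := fun h => by
        simp [T.mul_unit hab hbc h, T'.mul_unit hab hbc h, Edge.Hom.hom_unit] }
  mul_assoc hab hbc hcd f g k := by
    apply Edge.hom_ext
    rw [← cancel_mono ((T'.mul hab (hbc.trans hcd)).hom ≫ (_ ◁ (T'.mul hbc hcd).hom))]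
    conv_lhs => rw [mul_associativity]
    trans ((T.mul hab (hbc.trans hcd)).hom ≫ (_ ◁ (T.mul hbc hcd).hom)) ≫
      (Edge.Hom.hom f ⊗ₘ (Edge.Hom.hom g ⊗ₘ Edge.Hom.hom k))
    · simp only [mul_associativity, assoc, Iso.inv_hom_id_assoc,
        tensorHom_comp_whiskerRight_assoc, Iso.inv_hom_id, comp_id, ← associator_naturality,
        whiskerRight_comp_tensorHom_assoc]
    · simp only [assoc, Iso.inv_hom_id_assoc, whiskerLeft_comp_tensorHom,
        tensorHom_comp_whiskerLeft, Iso.inv_hom_id, comp_id]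

@[simp]
lemma homProduct_mul_hom (T T' : 𝓡.Diag K) {a b c : Fin (K.edges + 1)} (hab : a < b) (hbc : b < c)
    (f : T.edge a b hab ⟶ T'.edge a b hab) (g : T.edge b c hbc ⟶ T'.edge b c hbc) :
    Edge.Hom.hom ((homProduct T T').mul hab hbc f g) =
      (T.mul hab hbc).hom ≫ (Edge.Hom.hom f ⊗ₘ Edge.Hom.hom g) ≫ (T'.mul hab hbc).inv :=
  rfl

/-- The arrows between diagrams: the multiplicative families of arrows between the edges. -/
@[ext]
structure Hom (T T' : 𝓡.Diag K) where
  /-- the components -/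
  app : ∀ a b (hab : a < b), T.edge a b hab ⟶ T'.edge a b hab
  isMultiplicative : (homProduct T T').IsMultiplicative app

instance : Category.{v} (𝓡.Diag K) where
  Hom := Hom
  id T := ⟨fun _ _ _ => 𝟙 _, fun _ _ _ _ _ => Edge.hom_ext (by simp)⟩
  comp f g := ⟨fun a b hab => f.app a b hab ≫ g.app a b hab, fun a b c hab hbc =>
    Edge.hom_ext (by
      beta_reduce
      rw [f.isMultiplicative a b c hab hbc, g.isMultiplicative a b c hab hbc]
      simp)⟩

lemma Hom.app_mul {T T' : 𝓡.Diag K} (f : T ⟶ T') {a b c : Fin (K.edges + 1)} (hab : a < b)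
    (hbc : b < c) :
    Edge.Hom.hom (f.app a c (hab.trans hbc)) ≫ (T'.mul hab hbc).hom =
      (T.mul hab hbc).hom ≫ (Edge.Hom.hom (f.app a b hab) ⊗ₘ Edge.Hom.hom (f.app b c hbc)) := by
  simp [f.isMultiplicative a b c hab hbc]

variable (𝓡 K) in
/-- The diagrams of shape `K`, coloured by the componentwise weak equivalences. -/
def ccat : CCat.{v, max u v} where
  carrier := 𝓡.Diag K
  equi := fun _ _ f => ∀ a b hab, (Edge.ccat 𝓡 (K.Equi a b)).equi (Hom.app f a b hab)
  isMultiplicative :=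
    { id_mem := fun _ _ _ _ => (Edge.ccat 𝓡 _).equi.id_mem _
      comp_mem := fun _ _ hf hg a b hab =>
        (Edge.ccat 𝓡 _).equi.comp_mem _ _ (hf a b hab) (hg a b hab) }

/-- The restriction of diagrams. -/
def res (f : K ⟶ L) : ccat 𝓡 L ⟶ ccat 𝓡 K :=
  { functor :=
      { obj := fun T =>
          { edge := fun a b hab =>
              (Edge.forget (f.map_equi a b hab)).obj (T.edge _ _ (f.strictMono hab))
            isMultiplicative := fun a b c hab hbc =>
              congrArg (Edge.forget (f.map_equi a c (hab.trans hbc))).obj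
                (T.isMultiplicative _ _ _ (f.strictMono hab) (f.strictMono hbc)) }
        map := fun g =>
          { app := fun a b hab =>
              (Edge.forget (f.map_equi a b hab)).map (Hom.app g _ _ (f.strictMono hab))
            isMultiplicative := fun a b c hab hbc =>
              congrArg (Edge.forget (f.map_equi a c (hab.trans hbc))).map
                (Hom.isMultiplicative g _ _ _ (f.strictMono hab) (f.strictMono hbc)) } }
    map := fun _ _ _ hg _ _ _ => hg _ _ _ }

variable (𝓡) in
/-- The coloured categories of diagrams of all shapes. -/
def nerve : FatDeltaᵒᵖ ⥤ CCat.{v, max u v} where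
  obj K := ccat 𝓡 K.unop
  map f := res f.unop

/-- The evaluation of diagrams at an arrow, which is coloured if `p` holds. -/
def eval (a b : Fin (K.edges + 1)) (hab : a < b) {p : Prop} (h : p → K.Equi a b) :
    ccat 𝓡 K ⟶ Edge.ccat 𝓡 p :=
  { functor :=
      { obj := fun T => (Edge.forget h).obj (T.edge a b hab)
        map := fun f => (Edge.forget h).map (Hom.app f a b hab) }
    map := fun _ _ _ hf => hf a b hab }

/-! ## Diagrams are determined by their edges -/

variable (𝓡 K) in
/-- The restriction of diagrams to the edges of their shape. -/
def spine : ccat 𝓡 K ⟶ CCat.pi fun j : Fin K.edges => Edge.ccat 𝓡 (K.linked j = true) :=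
  CCat.piLift fun j => eval j.castSucc j.succ j.castSucc_lt_succ (K.equi_edge j).mpr

instance : (CCat.functor (spine 𝓡 K)).Faithful where
  map_injective {_ _} f g h := Hom.ext <|
    (Hom.isMultiplicative f).ext (Hom.isMultiplicative g) fun j =>
      congrArg (Edge.forget (K.equi_edge j).mp).map (congrFun h j :)

instance : (CCat.functor (spine 𝓡 K)).Full where
  map_surjective {T T'} f := by
    obtain ⟨g, hg, hgf⟩ := (homProduct T T').exists_isMultiplicative fun j =>
      (Edge.forget (K.equi_edge j).mp).map (f j)
    exact ⟨⟨g, hg⟩, funext fun j => congrArg (Edge.forget (K.equi_edge j).mpr).map (hgf j)⟩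

lemma spine_obj_injective : Function.Injective (CCat.functor (spine 𝓡 K)).obj := by
  rintro ⟨T, hT⟩ ⟨T', hT'⟩ h
  obtain rfl : T = T' := hT.ext hT' fun j =>
    congrArg (Edge.forget (K.equi_edge j).mp).obj (congrFun h j :)
  rfl

lemma spine_obj_surjective : Function.Surjective (CCat.functor (spine 𝓡 K)).obj := by
  intro x
  obtain ⟨T, hT, hTx⟩ := (𝓡.edgeProduct K).exists_isMultiplicative fun j =>
    (Edge.forget (K.equi_edge j).mp).obj (x j)
  exact ⟨⟨T, hT⟩, funext fun j => congrArg (Edge.forget (K.equi_edge j).mpr).obj (hTx j)⟩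

lemma equi_of_spine {T T' : ccat 𝓡 K} (f : T ⟶ T')
    (hf : (CCat.pi _).equi ((CCat.functor (spine 𝓡 K)).map f)) : (ccat 𝓡 K).equi f :=
  (Hom.isMultiplicative f).forall_of_edge
    (P := fun {a b hab} g => (Edge.ccat 𝓡 (K.Equi a b)).equi g)
    (fun {a b c} hab hbc {g g'} (hg : WeakEquivalence _) (hg' : WeakEquivalence _) => by
      have := MonoidalModelCategory.weakEquivalence_tensorHom
        (Edge.Hom.hom g) (Edge.Hom.hom g')
      change WeakEquivalence (_ ≫ _ ≫ _)
      infer_instance)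
    hf

instance : IsIso (spine 𝓡 K) :=
  CCat.isIso_of_bijective _ ⟨spine_obj_injective, spine_obj_surjective⟩ equi_of_spine

variable {C : CCat.{v, max u v}} {p : Fin K.edges → Prop}

lemma hom_ext_of_edges (hp : ∀ j, p j ↔ K.linked j = true) {φ ψ : C ⟶ ccat 𝓡 K}
    (h : ∀ j : Fin K.edges,
      φ ≫ eval j.castSucc j.succ j.castSucc_lt_succ ((hp j).trans (K.equi_edge j).symm).mp =
        ψ ≫ eval j.castSucc j.succ j.castSucc_lt_succ ((hp j).trans (K.equi_edge j).symm).mp) :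
    φ = ψ := by
  rw [← cancel_mono (spine 𝓡 K)]
  exact CCat.pi_hom_ext fun j => congrArg (· ≫ Edge.ccatForget 𝓡 (hp j).mpr) (h j)

lemma exists_lift_of_edges
    (θ : ∀ j : Fin K.edges, C ⟶ Edge.ccat 𝓡 (K.linked j = true)) :
    ∃ φ : C ⟶ ccat 𝓡 K, ∀ j : Fin K.edges,
      φ ≫ eval j.castSucc j.succ j.castSucc_lt_succ (K.equi_edge j).mpr = θ j := by
  refine ⟨CCat.piLift θ ≫ inv (spine 𝓡 K), fun j => ?_⟩
  have : spine 𝓡 K ≫ CCat.piEval _ j =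
    eval j.castSucc j.succ j.castSucc_lt_succ (K.equi_edge j).mpr := rfl
  rw [← this, assoc, IsIso.inv_hom_id_assoc, CCat.piLift_eval]

end Diag

end Strictification

/-! ## The Segal condition -/

namespace FatDelta

variable (K L : FatDelta)

/-- The concatenation of two strings, in which the last vertex of the first string is the first
vertex of the second string. -/
def concat : FatDelta := ⟨K.edges + L.edges, Fin.append K.linked L.linked⟩

/-- The inclusion of the first string into the concatenation. -/
def inl : K ⟶ concat K L :=
  homOfEdges (fun a => ⟨a, by have := a.isLt; simp only [concat]; omega⟩)
    (fun j => Nat.lt_succ_self _)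
    (fun j hj => ((concat K L).equi_edge (Fin.castAdd L.edges j)).mpr
      ((Fin.append_left K.linked L.linked j).trans hj))

/-- The inclusion of the second string into the concatenation. -/
def inr : L ⟶ concat K L :=
  homOfEdges (fun a => ⟨K.edges + a, by have := a.isLt; simp only [concat]; omega⟩)
    (fun j => Nat.lt_succ_self _)
    (fun j hj => ((concat K L).equi_edge (Fin.natAdd K.edges j)).mpr
      ((Fin.append_right K.linked L.linked j).trans hj))

variable {K L}

lemma exists_inl_or_exists_inr (a : Fin ((concat K L).edges + 1)) :
    (∃ b, (inl K L).toFun b = a) ∨ ∃ b, (inr K L).toFun b = a := by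
  have ha : (a : ℕ) < K.edges + L.edges + 1 := a.isLt
  rcases lt_or_ge (a : ℕ) (K.edges + 1) with h | h
  · exact .inl ⟨⟨a, h⟩, rfl⟩
  · exact .inr ⟨⟨a - K.edges, by omega⟩, Fin.ext (Nat.add_sub_cancel' (by omega))⟩

lemma exists_edge_inl_or_exists_edge_inr (j : Fin (concat K L).edges) :
    (∃ i, K.linked i = (concat K L).linked j ∧
      (inl K L).toFun i.castSucc = j.castSucc ∧ (inl K L).toFun i.succ = j.succ) ∨
    ∃ i, L.linked i = (concat K L).linked j ∧
      (inr K L).toFun i.castSucc = j.castSucc ∧ (inr K L).toFun i.succ = j.succ := by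
  induction j using Fin.addCases with
  | left i => exact .inl ⟨i, (Fin.append_left K.linked L.linked i).symm, rfl, rfl⟩
  | right i => exact .inr ⟨i, (Fin.append_right K.linked L.linked i).symm, rfl, rfl⟩

section glue

variable {P : FatDelta} (f : K ⟶ P) (g : L ⟶ P)

/-- The map on the vertices of a concatenation that is given by two maps that agree on the common
vertex. -/
def glueFun (a : Fin ((concat K L).edges + 1)) : Fin (P.edges + 1) :=
  if h : (a : ℕ) < K.edges + 1 then f.toFun ⟨a, h⟩ else
    g.toFun ⟨a - K.edges, by have : (a : ℕ) < K.edges + L.edges + 1 := a.isLt; omega⟩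

lemma glueFun_inl (a : Fin (K.edges + 1)) : glueFun f g ((inl K L).toFun a) = f.toFun a :=
  dif_pos a.isLt

variable {f g} (h : f.toFun (Fin.last _) = g.toFun 0)
include h

lemma glueFun_inr (a : Fin (L.edges + 1)) : glueFun f g ((inr K L).toFun a) = g.toFun a := by
  induction a using Fin.cases with
  | zero => exact (dif_pos (Nat.lt_succ_self _)).trans h
  | succ a =>
    have : ¬ K.edges + (a + 1 : ℕ) < K.edges + 1 := by omega
    exact (dif_neg this).trans (congrArg g.toFun (Fin.ext (Nat.add_sub_cancel_left _ _)))

/-- The arrow from a concatenation that is given by two arrows that agree on the common vertex. -/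
def glue : concat K L ⟶ P :=
  homOfEdges (glueFun f g)
    (fun j => by
      rcases exists_edge_inl_or_exists_edge_inr j with ⟨i, -, h₁, h₂⟩ | ⟨i, -, h₁, h₂⟩ <;>
        rw [← h₁, ← h₂]
      · simpa only [glueFun_inl] using f.strictMono i.castSucc_lt_succ
      · simpa only [glueFun_inr h] using g.strictMono i.castSucc_lt_succ)
    (fun j hj => by
      rcases exists_edge_inl_or_exists_edge_inr j with ⟨i, hi, h₁, h₂⟩ | ⟨i, hi, h₁, h₂⟩ <;>
        rw [← h₁, ← h₂]
      · simpa only [glueFun_inl] using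
          f.map_equi _ _ i.castSucc_lt_succ ((K.equi_edge i).mpr (hi.trans hj))
      · simpa only [glueFun_inr h] using
          g.map_equi _ _ i.castSucc_lt_succ ((L.equi_edge i).mpr (hi.trans hj)))

lemma inl_glue : inl K L ≫ glue h = f := hom_ext (glueFun_inl f g)

lemma inr_glue : inr K L ≫ glue h = g := hom_ext (glueFun_inr h)

end glue

lemma concat_hom_ext {P : FatDelta} {f g : concat K L ⟶ P} (hl : inl K L ≫ f = inl K L ≫ g)
    (hr : inr K L ≫ f = inr K L ≫ g) : f = g := by
  refine hom_ext fun a => ?_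
  rcases exists_inl_or_exists_inr a with ⟨b, rfl⟩ | ⟨b, rfl⟩
  · exact congrFun (congrArg Hom.toFun hl) b
  · exact congrFun (congrArg Hom.toFun hr) b

lemma isPushout_concat (K L : FatDelta) : IsPushout K.last L.first (inl K L) (inr K L) := by
  have h (s : PushoutCocone K.last L.first) : s.inl.toFun (Fin.last _) = s.inr.toFun 0 :=
    congrArg (fun f : dot ⟶ s.pt => f.toFun (0 : Fin 1)) s.condition
  exact ⟨⟨hom_ext fun _ => Fin.ext rfl⟩, ⟨PushoutCocone.IsColimit.mk _ (fun s => glue (h s))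
    (fun s => inl_glue (h s)) (fun s => inr_glue (h s)) fun s m hl hr =>
      concat_hom_ext (hl.trans (inl_glue (h s)).symm) (hr.trans (inr_glue (h s)).symm)⟩⟩

end FatDelta

namespace Strictification

variable {M : Type u} [Category.{v} M] [MonoidalCategory M] [ModelCategory M]
  [MonoidalModelCategory M] {𝓡 : Strictification M} {K L : FatDelta}

namespace Diag

instance : Unique (ccat 𝓡 FatDelta.dot) where
  default := ⟨fun a b hab => absurd hab (Subsingleton.elim (α := Fin 1) a b).not_lt,
    fun a b _ hab => absurd hab (Subsingleton.elim (α := Fin 1) a b).not_lt⟩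
  uniq _ := spine_obj_injective (funext fun j => j.elim0)

instance : IsDiscrete (ccat 𝓡 FatDelta.dot) where
  subsingleton _ _ :=
    ⟨fun _ _ => (CCat.functor (spine 𝓡 FatDelta.dot)).map_injective (funext fun j => j.elim0)⟩
  eq_of_hom _ := Subsingleton.elim _ _

lemma concat_hom_ext {C : CCat.{v, max u v}} {φ ψ : C ⟶ ccat 𝓡 (K.concat L)}
    (hl : φ ≫ res (FatDelta.inl K L) = ψ ≫ res (FatDelta.inl K L))
    (hr : φ ≫ res (FatDelta.inr K L) = ψ ≫ res (FatDelta.inr K L)) : φ = ψ := by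
  refine hom_ext_of_edges (fun _ => Iff.rfl) fun j => ?_
  induction j using Fin.addCases with
  | left j => exact congrArg (· ≫ eval j.castSucc j.succ j.castSucc_lt_succ fun hj =>
      (K.equi_edge j).mpr ((Fin.append_left K.linked L.linked j).symm.trans hj)) hl
  | right j => exact congrArg (· ≫ eval j.castSucc j.succ j.castSucc_lt_succ fun hj =>
      (L.equi_edge j).mpr ((Fin.append_right K.linked L.linked j).symm.trans hj)) hr

lemma exists_concat_lift {C : CCat.{v, max u v}} (φ : C ⟶ ccat 𝓡 K) (ψ : C ⟶ ccat 𝓡 L) :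
    ∃ χ : C ⟶ ccat 𝓡 (K.concat L),
      χ ≫ res (FatDelta.inl K L) = φ ∧ χ ≫ res (FatDelta.inr K L) = ψ := by
  have hl (j : Fin K.edges) := Fin.append_left K.linked L.linked j
  have hr (j : Fin L.edges) := Fin.append_right K.linked L.linked j
  obtain ⟨χ, hχ⟩ := exists_lift_of_edges (𝓡 := 𝓡) (K := K.concat L) (C := C)
    (Fin.addCases (motive := fun j => C ⟶ Edge.ccat 𝓡 ((K.concat L).linked j = true))
      (fun j => φ ≫ eval j.castSucc j.succ j.castSucc_lt_succ fun hj =>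
        (K.equi_edge j).mpr ((hl j).symm.trans hj))
      (fun j => ψ ≫ eval j.castSucc j.succ j.castSucc_lt_succ fun hj =>
        (L.equi_edge j).mpr ((hr j).symm.trans hj)))
  refine ⟨χ, hom_ext_of_edges (fun j => by rw [← hl]) fun j => ?_,
    hom_ext_of_edges (fun j => by rw [← hr]) fun j => ?_⟩
  · exact (hχ (Fin.castAdd L.edges j)).trans (Fin.addCases_left j)
  · exact (hχ (Fin.natAdd K.edges j)).trans (Fin.addCases_right j)

lemma isPullback_concat (K L : FatDelta) :
    IsPullback ((nerve 𝓡).map (FatDelta.inl K L).op) ((nerve 𝓡).map (FatDelta.inr K L).op)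
      ((nerve 𝓡).map K.last.op) ((nerve 𝓡).map L.first.op) := by
  have subsingleton (C : CCat.{v, max u v}) : Subsingleton (C ⟶ ccat 𝓡 FatDelta.dot) :=
    CCat.subsingleton_hom
  choose lift hl hr using fun {C : CCat.{v, max u v}} => exists_concat_lift (𝓡 := 𝓡) (K := K)
    (L := L) (C := C)
  exact ⟨⟨(subsingleton _).elim _ _⟩, ⟨PullbackCone.IsLimit.mk _ (fun s => lift s.fst s.snd)
    (fun s => hl s.fst s.snd) (fun s => hr s.fst s.snd) fun s m h₁ h₂ =>
      concat_hom_ext (h₁.trans (hl s.fst s.snd).symm) (h₂.trans (hr s.fst s.snd).symm)⟩⟩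

lemma isPullback_of_isPushout {P : FatDelta} {i : K ⟶ P} {j : L ⟶ P}
    (h : IsPushout K.last L.first i j) :
    IsPullback ((nerve 𝓡).map i.op) ((nerve 𝓡).map j.op)
      ((nerve 𝓡).map K.last.op) ((nerve 𝓡).map L.first.op) := by
  let e := h.isoIsPushout _ _ (FatDelta.isPushout_concat K L)
  refine (isPullback_concat K L).of_iso ((nerve 𝓡).mapIso e.op) (Iso.refl _) (Iso.refl _)
    (Iso.refl _) ?_ ?_ (by simp) (by simp)
  all_goals
    simp only [Iso.refl_hom, Category.comp_id, Functor.mapIso_hom, Iso.op_hom, ← Functor.map_comp,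
      ← op_comp]
  · rw [IsPushout.inl_isoIsPushout_hom]
  · rw [IsPushout.inr_isoIsPushout_hom]

end Diag

end Strictification

/-! ## The uncoloured edges of a semi-ordinal -/

namespace FatDelta

variable {K : FatDelta}

lemma component_succ_of_linked {j : Fin K.edges} (hj : K.linked j = true) :
    K.component j.succ = K.component j.castSucc := by
  refine congrArg Finset.card (Finset.filter_congr fun i _ => and_congr_left fun hi => ?_)
  have hij : i ≠ j := fun h => by simp [h, hj] at hi
  simp only [Fin.castSucc_lt_succ_iff, Fin.castSucc_lt_castSucc_iff, hij.le_iff_lt]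

lemma component_succ_of_not_linked {j : Fin K.edges} (hj : K.linked j = false) :
    K.component j.succ = K.component j.castSucc + 1 := by
  rw [component, component, ← Finset.card_insert_of_notMem (a := j) (by simp)]
  congr 1
  ext i
  simp only [Finset.mem_filter_univ, Finset.mem_insert, Fin.castSucc_lt_succ_iff,
    Fin.castSucc_lt_castSucc_iff, le_iff_eq_or_lt]
  grind

lemma component_mono : Monotone K.component := fun _ _ hab =>
  Finset.card_le_card (Finset.monotone_filter_right _ fun _ _ h => ⟨h.1.trans_le hab, h.2⟩)

lemma equi_of_component_eq {a b : Fin (K.edges + 1)} (h : K.component a = K.component b) :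
    K.Equi a b := by
  intro j ha hb
  by_contra hj
  have := component_succ_of_not_linked (Bool.eq_false_of_not_eq_true hj)
  have := component_mono ha
  have := component_mono hb
  omega

lemma exists_component_eq {c : ℕ} {a : Fin (K.edges + 1)} (hc : c < K.component a) :
    ∃ j : Fin K.edges, K.linked j = false ∧ K.component j.castSucc = c := by
  induction a using Fin.induction with
  | zero => simp [component] at hc
  | succ j ih =>
    by_cases hcj : c < K.component j.castSucc
    · exact ih hcj
    · cases hj : K.linked j with
      | true => exact absurd (hc.trans_eq (component_succ_of_linked hj)) hcj
      | false => exact ⟨j, hj, by have := component_succ_of_not_linked hj; omega⟩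

lemma eq_of_component_eq {i j : Fin K.edges} (hi : K.linked i = false) (hj : K.linked j = false)
    (h : K.component i.castSucc = K.component j.castSucc) : i = j := by
  by_contra hij
  rcases lt_or_gt_of_ne hij with hij | hij
  · exact absurd (equi_of_component_eq h i le_rfl hij) (by simp [hi])
  · exact absurd (equi_of_component_eq h.symm j le_rfl hij) (by simp [hj])

/-- The uncoloured edge with the given number, counting from `0`. -/
def uncolouredEdge (K : FatDelta) {c : ℕ} (hc : c < K.component (Fin.last _)) : Fin K.edges :=
  (exists_component_eq hc).choose

section

variable {c : ℕ} (hc : c < K.component (Fin.last _))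

lemma linked_uncolouredEdge : K.linked (K.uncolouredEdge hc) = false :=
  (exists_component_eq hc).choose_spec.1

lemma component_uncolouredEdge : K.component (K.uncolouredEdge hc).castSucc = c :=
  (exists_component_eq hc).choose_spec.2

lemma component_uncolouredEdge_succ : K.component (K.uncolouredEdge hc).succ = c + 1 := by
  rw [component_succ_of_not_linked (linked_uncolouredEdge hc), component_uncolouredEdge]

end

lemma exists_uncolouredEdge_eq {j : Fin K.edges} (hj : K.linked j = false) :
    ∃ (c : ℕ) (hc : c < K.component (Fin.last _)), K.uncolouredEdge hc = j := by
  have hc : K.component j.castSucc < K.component (Fin.last _) := by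
    have := component_succ_of_not_linked hj
    have := K.component_mono (Fin.le_last j.succ)
    omega
  exact ⟨_, hc, eq_of_component_eq (linked_uncolouredEdge _) hj (component_uncolouredEdge _)⟩

end FatDelta

/-! ## Homotopies of functors into a product -/

namespace CCat

variable {C D E : CCat.{v, u}}

/-- The constant functor. -/
def const (C : CCat.{v, u}) {D : CCat.{v, u}} (z : D) : C ⟶ D :=
  { functor := (Functor.const C).obj z, map := fun _ _ _ _ => D.equi.id_mem _ }

namespace ColouredTrans

/-- The identity transformation. -/
def refl (φ : C ⟶ D) : ColouredTrans φ φ := ⟨𝟙 _, fun _ => D.equi.id_mem _⟩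

/-- The composite of two transformations. -/
def comp {φ ψ χ : C ⟶ D} (α : ColouredTrans φ ψ) (β : ColouredTrans ψ χ) : ColouredTrans φ χ :=
  ⟨α.trans ≫ β.trans, fun x => D.equi.comp_mem _ _ (α.equi x) (β.equi x)⟩

/-- The precomposition of a transformation with a functor. -/
def precomp (φ : C ⟶ D) {ψ χ : D ⟶ E} (α : ColouredTrans ψ χ) :
    ColouredTrans (φ ≫ ψ) (φ ≫ χ) :=
  ⟨Functor.whiskerLeft (functor φ) α.trans, fun x => α.equi ((functor φ).obj x)⟩

/-- The transformation of functors into a product that is given by its components. -/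
def piLift {ι : Type} {C : ι → CCat.{v, u}} {φ ψ : ∀ i, D ⟶ C i}
    (α : ∀ i, ColouredTrans (φ i) (ψ i)) : ColouredTrans (piLift φ) (piLift ψ) where
  trans := { app := fun x i => (α i).trans.app x
             naturality := fun _ _ f => funext fun i => (α i).trans.naturality f }
  equi x i := (α i).equi x

end ColouredTrans

lemma toHo_map_piLift_eq {ι : Type} {C : ι → CCat.{v, u}} {φ ψ : ∀ i, D ⟶ C i}
    (h : ∀ i, ∃ χ, Nonempty (ColouredTrans (φ i) χ) ∧ Nonempty (ColouredTrans (ψ i) χ)) :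
    toHo.map (piLift φ) = toHo.map (piLift ψ) := by
  choose χ α β using h
  exact (toHo_map_eq (.piLift fun i => (α i).some)).trans
    (toHo_map_eq (.piLift fun i => (β i).some)).symm

end CCat

namespace Strictification

variable {M : Type u} [Category.{v} M] [MonoidalCategory M] [ModelCategory M]
  {𝓡 : Strictification M}

/-! ## The coloured edges are contractible -/

namespace Edge

variable {p : Prop} (hp : p)

include hp in
lemma weakEquivalence_hom {x y : 𝓡.Edge p} (f : x ⟶ y) : WeakEquivalence (Hom.hom f) :=
  weakEquivalence_of_postcomp_of_fac (f.hom_unit hp)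

/-- The functor that views a coloured edge as an object over the unit object. -/
def toOver : 𝓡.Edge p ⥤ Over (𝟙_ M) where
  obj x := Over.mk (x.unit hp)
  map f := Over.homMk f.hom (f.hom_unit hp)

/-- The functor `toOver` is fully faithful. -/
def fullyFaithfulToOver : (toOver (𝓡 := 𝓡) hp).FullyFaithful where
  preimage f := ⟨f.left, fun _ => Over.w f⟩

lemma essImage_toOver (A : Over (𝟙_ M)) [IsCofibrant A.left] [hA : WeakEquivalence A.hom] :
    (toOver (𝓡 := 𝓡) hp).essImage A := by
  obtain ⟨s, hs⟩ := 𝓡.exists_eq A.left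
  exact ⟨⟨s, fun _ => eqToHom hs ≫ A.hom, fun _ => inferInstance⟩,
    ⟨Over.isoMk (eqToIso hs) rfl⟩⟩

instance : Nonempty (𝓡.Edge p) := by
  let d := MorphismProperty.factorizationData (cofibrations M) (trivialFibrations M)
    (initial.to (𝟙_ M))
  have : Cofibration d.i := ⟨d.hi⟩
  have : IsCofibrant d.Z := (isCofibrant_iff_of_isInitial d.i initialIsInitial).mpr this
  obtain ⟨s, hs⟩ := 𝓡.exists_eq d.Z
  have : WeakEquivalence d.p := inferInstance
  exact ⟨⟨s, fun _ => eqToHom hs ≫ d.p, fun _ => inferInstance⟩⟩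

variable [MonoidalModelCategory M]

include hp in
lemma exists_cospan (z : ccat 𝓡 p) : ∃ ρ : ccat 𝓡 p ⟶ ccat 𝓡 p,
    Nonempty (CCat.ColouredTrans (𝟙 _) ρ) ∧ Nonempty (CCat.ColouredTrans (CCat.const _ z) ρ) := by
  obtain ⟨⟨data⟩⟩ := MonoidalModelCategory.functorial₁ (M := M)
  let F := toOver (𝓡 := 𝓡) hp
  let P := MonoidalModelCategory.replacement data (F.obj z)
  have hF : F.FullyFaithful := fullyFaithfulToOver hp
  have := hF.full
  have := hF.faithful
  have hP (x : 𝓡.Edge p) : F.essImage (P.obj (F.obj x)) := by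
    have : IsCofibrant (F.obj x).left := 𝓡.isCofibrant x.obj
    have : IsCofibrant (F.obj z).left := 𝓡.isCofibrant (Edge.obj z)
    have := MonoidalModelCategory.isCofibrant_replacement_obj_left data (F.obj z) (F.obj x)
    have := MonoidalModelCategory.weakEquivalence_replacement_obj_hom data (F.obj z) (F.obj x)
    exact essImage_toOver hp _
  let R := Functor.essImage.liftFunctor (F ⋙ P) F hP
  let e : R ⋙ F ≅ F ⋙ P := Functor.essImage.liftFunctorCompIso (F ⋙ P) F hP
  have hR : (ccat 𝓡 p).equi ≤ (ccat 𝓡 p).equi.inverseImage R := fun _ _ _ _ =>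
    weakEquivalence_hom hp _
  let α : 𝟭 _ ⟶ R := (hF.whiskeringRight _).preimage
    (Functor.whiskerLeft F (MonoidalModelCategory.toReplacement data (F.obj z)) ≫ e.inv)
  let β : (Functor.const _).obj z ⟶ R := (hF.whiskeringRight _).preimage
    (Functor.whiskerLeft F (MonoidalModelCategory.constToReplacement data (F.obj z)) ≫ e.inv)
  exact ⟨{ functor := R, map := hR }, ⟨⟨α, fun _ => weakEquivalence_hom hp _⟩⟩,
    ⟨⟨β, fun _ => weakEquivalence_hom hp _⟩⟩⟩

include hp in
lemma exists_cospan_const {C : CCat.{v, max u v}} (φ : C ⟶ ccat 𝓡 p) (z : ccat 𝓡 p) :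
    ∃ χ, Nonempty (CCat.ColouredTrans φ χ) ∧ Nonempty (CCat.ColouredTrans (CCat.const C z) χ) := by
  obtain ⟨ρ, ⟨α⟩, ⟨β⟩⟩ := exists_cospan hp z
  exact ⟨φ ≫ ρ, ⟨α.precomp φ⟩, ⟨β.precomp φ⟩⟩

end Edge

/-! ## Vertical arrows -/

namespace Diag

variable [MonoidalModelCategory M] {K L : FatDelta}

lemma weakEquivalence_mul_whiskerRight_unit (T : 𝓡.Diag K) {a b c : Fin (K.edges + 1)}
    (hab : a < b) (hbc : b < c) (h : K.Equi a b) :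
    WeakEquivalence ((T.mul hab hbc).hom ≫ ((T.edge a b hab).unit h ▷ _) ≫ (λ_ _).hom) := by
  have := MonoidalModelCategory.unit_left _ (𝓡.r (T.edge b c hbc).obj) inferInstance
    ((T.edge a b hab).weakEquivalence_unit h) inferInstance
  infer_instance

lemma weakEquivalence_mul_whiskerLeft_unit (T : 𝓡.Diag K) {a b c : Fin (K.edges + 1)}
    (hab : a < b) (hbc : b < c) (h : K.Equi b c) :
    WeakEquivalence ((T.mul hab hbc).hom ≫ (_ ◁ (T.edge b c hbc).unit h) ≫ (ρ_ _).hom) := by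
  have := MonoidalModelCategory.unit_right _ (𝓡.r (T.edge a b hab).obj) inferInstance
    ((T.edge b c hbc).weakEquivalence_unit h) inferInstance
  infer_instance

lemma mul_whiskerRight_unit_naturality {T T' : 𝓡.Diag K} (f : T ⟶ T') {a b c : Fin (K.edges + 1)}
    (hab : a < b) (hbc : b < c) (h : K.Equi a b) :
    Edge.Hom.hom (f.app a c (hab.trans hbc)) ≫
        (T'.mul hab hbc).hom ≫ ((T'.edge a b hab).unit h ▷ _) ≫ (λ_ _).hom =
      ((T.mul hab hbc).hom ≫ ((T.edge a b hab).unit h ▷ _) ≫ (λ_ _).hom) ≫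
        Edge.Hom.hom (f.app b c hbc) := by
  rw [reassoc_of% Hom.app_mul f hab hbc, ← (f.app a b hab).hom_unit h,
    MonoidalCategory.tensorHom_def', comp_whiskerRight]
  simp only [assoc]
  rw [whisker_exchange_assoc, whisker_exchange_assoc, leftUnitor_naturality]

lemma mul_whiskerLeft_unit_naturality {T T' : 𝓡.Diag K} (f : T ⟶ T') {a b c : Fin (K.edges + 1)}
    (hab : a < b) (hbc : b < c) (h : K.Equi b c) :
    Edge.Hom.hom (f.app a c (hab.trans hbc)) ≫
        (T'.mul hab hbc).hom ≫ (_ ◁ (T'.edge b c hbc).unit h) ≫ (ρ_ _).hom =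
      ((T.mul hab hbc).hom ≫ (_ ◁ (T.edge b c hbc).unit h) ≫ (ρ_ _).hom) ≫
        Edge.Hom.hom (f.app a b hab) := by
  rw [reassoc_of% Hom.app_mul f hab hbc, ← (f.app b c hbc).hom_unit h,
    MonoidalCategory.tensorHom_def, MonoidalCategory.whiskerLeft_comp]
  simp only [assoc]
  rw [← whisker_exchange_assoc, ← whisker_exchange_assoc, rightUnitor_naturality]

/-- A coloured edge on the left can be dropped, since it is weakly equivalent to the unit
object. -/
def dropLeft {a b c : Fin (K.edges + 1)} (hab : a < b) (hbc : b < c) (h : K.Equi a b) :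
    CCat.ColouredTrans (eval (𝓡 := 𝓡) a c (hab.trans hbc) False.elim)
      (eval b c hbc False.elim) where
  trans :=
    { app := fun T =>
        ⟨(mul T hab hbc).hom ≫ ((edge T a b hab).unit h ▷ _) ≫ (λ_ _).hom, fun h => h.elim⟩
      naturality := fun _ _ f => Edge.hom_ext (mul_whiskerRight_unit_naturality f hab hbc h) }
  equi T := weakEquivalence_mul_whiskerRight_unit T hab hbc h

/-- A coloured edge on the right can be dropped, since it is weakly equivalent to the unit
object. -/
def dropRight {a b c : Fin (K.edges + 1)} (hab : a < b) (hbc : b < c) (h : K.Equi b c) :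
    CCat.ColouredTrans (eval (𝓡 := 𝓡) a c (hab.trans hbc) False.elim)
      (eval a b hab False.elim) where
  trans :=
    { app := fun T =>
        ⟨(mul T hab hbc).hom ≫ (_ ◁ (edge T b c hbc).unit h) ≫ (ρ_ _).hom, fun h => h.elim⟩
      naturality := fun _ _ f => Edge.hom_ext (mul_whiskerLeft_unit_naturality f hab hbc h) }
  equi T := weakEquivalence_mul_whiskerLeft_unit T hab hbc h

lemma nonempty_colouredTrans_eval {a b c d : Fin (K.edges + 1)} (hab : a ≤ b) (hbc : b < c)
    (hcd : c ≤ d) (h : K.Equi a b) (h' : K.Equi c d) :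
    Nonempty (CCat.ColouredTrans (eval (𝓡 := 𝓡) a d (hab.trans_lt (hbc.trans_le hcd)) False.elim)
      (eval b c hbc False.elim)) := by
  have left : Nonempty (CCat.ColouredTrans
      (eval (𝓡 := 𝓡) a d (hab.trans_lt (hbc.trans_le hcd)) False.elim)
      (eval b d (hbc.trans_le hcd) False.elim)) := by
    rcases hab.eq_or_lt with rfl | hab
    · exact ⟨.refl _⟩
    · exact ⟨dropLeft hab (hbc.trans_le hcd) h⟩
  have right : Nonempty (CCat.ColouredTrans (eval (𝓡 := 𝓡) b d (hbc.trans_le hcd) False.elim)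
      (eval b c hbc False.elim)) := by
    rcases hcd.eq_or_lt with rfl | hcd
    · exact ⟨.refl _⟩
    · exact ⟨dropRight hbc hcd h'⟩
  exact ⟨left.some.comp right.some⟩

variable (𝓡) in
/-- The restriction of diagrams to the uncoloured edges of their shape. Their number is a separate
variable, so that it can be the same for several shapes. -/
def uncoloured {n : ℕ} (hn : n = K.component (Fin.last _)) :
    ccat 𝓡 K ⟶ CCat.pi fun _ : Fin n => Edge.ccat 𝓡 False :=
  CCat.piLift fun c => eval _ _ (K.uncolouredEdge (c.isLt.trans_eq hn)).castSucc_lt_succ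
    False.elim

section

variable {n : ℕ} (hn : n = K.component (Fin.last _))

lemma exists_edge_of_uncoloured (j : Fin K.edges) :
    ∃ θ : CCat.pi (fun _ : Fin n => Edge.ccat 𝓡 False) ⟶ Edge.ccat 𝓡 (K.linked j = true),
      (∀ c : Fin n, K.uncolouredEdge (c.isLt.trans_eq hn) = j →
        θ ≫ Edge.ccatForget 𝓡 False.elim = CCat.piEval _ c) ∧
      ∃ χ, Nonempty (CCat.ColouredTrans (uncoloured 𝓡 hn ≫ θ) χ) ∧
        Nonempty (CCat.ColouredTrans
          (eval j.castSucc j.succ j.castSucc_lt_succ (K.equi_edge j).mpr) χ) := by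
  by_cases hj : K.linked j = true
  · obtain ⟨z⟩ : Nonempty (𝓡.Edge (K.linked j = true)) := inferInstance
    obtain ⟨χ, α, β⟩ := Edge.exists_cospan_const hj
      (eval (𝓡 := 𝓡) j.castSucc j.succ j.castSucc_lt_succ (K.equi_edge j).mpr) z
    refine ⟨CCat.const _ z, fun c hc => ?_, χ, β, α⟩
    simp [← hc, FatDelta.linked_uncolouredEdge] at hj
  · obtain ⟨c, hc, rfl⟩ := FatDelta.exists_uncolouredEdge_eq (Bool.eq_false_of_not_eq_true hj)
    refine ⟨CCat.piEval _ ⟨c, hc.trans_eq hn.symm⟩ ≫ Edge.ccatForget 𝓡 hj,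
      fun d hd => ?_, _, ⟨.refl _⟩, ⟨.refl _⟩⟩
    obtain rfl : c = d := by
      rw [← FatDelta.component_uncolouredEdge hc, ← hd, FatDelta.component_uncolouredEdge]
    rfl

lemma exists_section_uncoloured : ∃ σ, σ ≫ uncoloured 𝓡 hn = 𝟙 _ ∧
    CCat.toHo.map (uncoloured 𝓡 hn ≫ σ ≫ spine 𝓡 K) = CCat.toHo.map (spine 𝓡 K) := by
  choose θ hθ hχ using exists_edge_of_uncoloured (𝓡 := 𝓡) hn
  obtain ⟨σ, hσ⟩ := exists_lift_of_edges θ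
  refine ⟨σ, CCat.pi_hom_ext fun c => ?_, ?_⟩
  · exact (congrArg (· ≫ Edge.ccatForget 𝓡 False.elim) (hσ _)).trans (hθ _ c rfl)
  · have : uncoloured 𝓡 hn ≫ σ ≫ spine 𝓡 K = CCat.piLift fun j => uncoloured 𝓡 hn ≫ θ j :=
      CCat.pi_hom_ext fun j => congrArg (uncoloured 𝓡 hn ≫ ·) (hσ j)
    rw [this]
    exact CCat.toHo_map_piLift_eq hχ

instance : IsIso (CCat.toHo.map (uncoloured 𝓡 hn)) := by
  obtain ⟨σ, hσ, h⟩ := exists_section_uncoloured (𝓡 := 𝓡) hn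
  refine ⟨CCat.toHo.map σ, ?_, by rw [← Functor.map_comp, hσ, CategoryTheory.Functor.map_id]⟩
  rw [← cancel_mono (CCat.toHo.map (spine 𝓡 K)), Category.id_comp, assoc,
    ← Functor.map_comp, ← Functor.map_comp, h]

end

lemma toHo_map_res_comp_uncoloured {f : K ⟶ L} (hf : FatDelta.vertical f) :
    CCat.toHo.map (res f ≫ uncoloured 𝓡 rfl) = CCat.toHo.map (uncoloured 𝓡 hf.1) := by
  have h (c : Fin (K.component (Fin.last _))) : Nonempty (CCat.ColouredTrans
      (res f ≫ eval (𝓡 := 𝓡) _ _ (K.uncolouredEdge c.isLt).castSucc_lt_succ False.elim)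
      (eval _ _ (L.uncolouredEdge (c.isLt.trans_eq hf.1)).castSucc_lt_succ False.elim)) := by
    have hK := (hf.2 _).trans (FatDelta.component_uncolouredEdge c.isLt)
    have hK' := (hf.2 _).trans (FatDelta.component_uncolouredEdge_succ c.isLt)
    have hL := FatDelta.component_uncolouredEdge (c.isLt.trans_eq hf.1)
    have hL' := FatDelta.component_uncolouredEdge_succ (c.isLt.trans_eq hf.1)
    refine nonempty_colouredTrans_eval (Fin.le_castSucc_iff.mpr ?_) Fin.castSucc_lt_succ
      (Fin.castSucc_lt_iff_succ_le.mp ?_) (FatDelta.equi_of_component_eq (hK.trans hL.symm))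
      (FatDelta.equi_of_component_eq (hL'.trans hK'.symm))
    · exact FatDelta.component_mono.reflect_lt (by omega)
    · exact FatDelta.component_mono.reflect_lt (by omega)
  exact CCat.toHo_map_eq (.piLift fun c => (h c).some)

lemma equifunctors_of_vertical {f : K ⟶ L} (hf : FatDelta.vertical f) :
    CCat.equifunctors (res (𝓡 := 𝓡) f) := by
  have h : CCat.toHo.map (res f) ≫ CCat.toHo.map (uncoloured 𝓡 rfl) =
      CCat.toHo.map (uncoloured 𝓡 hf.1) := by
    rw [← Functor.map_comp, toHo_map_res_comp_uncoloured hf]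
  have : IsIso (CCat.toHo.map (res (𝓡 := 𝓡) f)) := IsIso.of_isIso_fac_right h
  exact CCat.equifunctors_of_isIso_toHo_map _

variable (𝓡) in
lemma isFairMonoid_nerve : IsFairMonoid (nerve 𝓡) where
  discrete := inferInstanceAs (IsDiscrete (ccat 𝓡 FatDelta.dot))
  segal _ _ h := isPullback_of_isPushout h
  colours _ hf := equifunctors_of_vertical hf
  singleton := ⟨inferInstanceAs (Unique (ccat 𝓡 FatDelta.dot))⟩

end Diag

end Strictification

/-! ## The category of arrows and the category of weak units -/

namespace CCat

variable {C D : CCat.{v, u}} (φ : C ⟶ D) [IsIso φ]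

lemma functor_comp_functor_inv : functor φ ⋙ functor (inv φ) = 𝟭 C :=
  congrArg functor (IsIso.hom_inv_id φ)

lemma functor_inv_comp_functor : functor (inv φ) ⋙ functor φ = 𝟭 D :=
  congrArg functor (IsIso.inv_hom_id φ)

instance isEquivalence_functor : (functor φ).IsEquivalence :=
  (CategoryTheory.Equivalence.mk (functor φ) (functor (inv φ))
    (eqToIso (functor_comp_functor_inv φ).symm)
    (eqToIso (functor_inv_comp_functor φ))).isEquivalence_functor

lemma bijective_functor_obj : Function.Bijective (functor φ).obj :=
  Function.bijective_iff_has_inverse.mpr ⟨(functor (inv φ)).obj,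
    Functor.congr_obj (functor_comp_functor_inv φ), Functor.congr_obj (functor_inv_comp_functor φ)⟩

lemma equi_map_iff {x y : C} (f : x ⟶ y) : D.equi ((functor φ).map f) ↔ C.equi f := by
  refine ⟨fun hf => ?_, functor_map_equi φ⟩
  have h : f = eqToHom _ ≫ (functor (inv φ)).map ((functor φ).map f) ≫ eqToHom _ :=
    Functor.congr_hom (functor_comp_functor_inv φ).symm f
  rw [h]
  exact C.equi.comp_mem _ _ (equi_eqToHom _)
    (C.equi.comp_mem _ _ (functor_map_equi (inv φ) hf) (equi_eqToHom _))

end CCat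

namespace Strictification

variable {M : Type u} [Category.{v} M] [MonoidalCategory M] [ModelCategory M]
  (𝓡 : Strictification M)

lemma exists_mulIso_hom_eq_eqToHom (hμ : ∀ s t, ∃ h, (𝓡.μ s t).hom = eqToHom h) {s t w : 𝓡.S}
    (hw : w = s * t) : ∃ h, (𝓡.mulIso hw).hom = eqToHom h := by
  subst hw
  obtain ⟨h, e⟩ := hμ s t
  exact ⟨h, by simp [mulIso, e]⟩

namespace Edge

/-- The functor from the uncoloured edges to the cofibrant objects. -/
def toCofibrantObject : ccat 𝓡 False ⥤ CofibrantObject M where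
  obj (x : 𝓡.Edge False) := CofibrantObject.mk (𝓡.r x.obj)
  map f := CofibrantObject.homMk (Hom.hom f)

lemma toCofibrantObject_obj_surjective :
    Function.Surjective (toCofibrantObject 𝓡).obj := by
  rintro ⟨Z, hZ⟩
  have : IsCofibrant Z := hZ
  obtain ⟨s, rfl⟩ := 𝓡.exists_eq Z
  exact ⟨⟨s, nofun, nofun⟩, rfl⟩

instance : (toCofibrantObject 𝓡).IsEquivalence where
  faithful := ⟨fun h => hom_ext (congrArg InducedCategory.Hom.hom h)⟩
  full := ⟨fun f => ⟨⟨f.hom, nofun⟩, rfl⟩⟩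
  essSurj := ⟨fun Z => by
    obtain ⟨x, rfl⟩ := toCofibrantObject_obj_surjective 𝓡 Z
    exact Functor.obj_mem_essImage _ _⟩

lemma toCofibrantObject_obj_injective {𝓡 : Strictification M} (h : Function.Injective 𝓡.r) :
    Function.Injective (toCofibrantObject 𝓡).obj := fun _ _ hxy =>
  ext' (h (congrArg (·.obj) hxy)) nofun

/-- The functor from the coloured edges to the weak units. -/
def toWeakUnits : ccat 𝓡 True ⥤ WeakUnits M where
  obj (x : 𝓡.Edge True) := ⟨CostructuredArrow.mk (S := CofibrantObject.ι)
    (Y := CofibrantObject.mk (𝓡.r x.obj)) (x.unit trivial), x.weakEquivalence_unit trivial⟩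
  map f := ⟨CostructuredArrow.homMk (CofibrantObject.homMk (Hom.hom f)) (Hom.hom_unit f trivial)⟩

lemma toWeakUnits_obj_surjective : Function.Surjective (toWeakUnits 𝓡).obj := by
  rintro ⟨⟨⟨Z, hZ⟩, ⟨⟨⟩⟩, w⟩, hw⟩
  have : IsCofibrant Z := hZ
  obtain ⟨s, rfl⟩ := 𝓡.exists_eq Z
  exact ⟨⟨s, fun _ => w, fun _ => hw⟩, rfl⟩

instance : (toWeakUnits 𝓡).IsEquivalence where
  faithful := ⟨fun h => hom_ext (congrArg (·.hom.left.hom) h)⟩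
  full := ⟨fun f => ⟨⟨f.hom.left.hom, fun _ => CostructuredArrow.w f.hom⟩, rfl⟩⟩
  essSurj := ⟨fun Z => by
    obtain ⟨x, rfl⟩ := toWeakUnits_obj_surjective 𝓡 Z
    exact Functor.obj_mem_essImage _ _⟩

lemma toWeakUnits_obj_injective {𝓡 : Strictification M} (h : Function.Injective 𝓡.r) :
    Function.Injective (toWeakUnits 𝓡).obj := by
  rintro ⟨s, w, hw⟩ ⟨s', w', hw'⟩ hxy
  obtain rfl : s = s' := h (congrArg (·.obj.left.obj) hxy)
  obtain rfl : w = w' := funext fun _ => eq_of_heq (congr_arg_heq (·.obj.hom) hxy)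
  rfl

end Edge

namespace Diag

variable [MonoidalModelCategory M]

/-- The evaluation of diagrams at the only edge of their shape. -/
def arrowEdge {l : Bool} {p : Prop} (hp : p ↔ l = true) :
    ccat 𝓡 ⟨1, fun _ => l⟩ ⟶ Edge.ccat 𝓡 p :=
  eval (K := ⟨1, fun _ => l⟩) (0 : Fin 2) (1 : Fin 2) (zero_lt_one (α := Fin 2))
    fun h _ _ _ => hp.mp h

instance {l : Bool} {p : Prop} (hp : p ↔ l = true) : IsIso (arrowEdge 𝓡 hp) := by
  obtain ⟨φ, hφ⟩ := exists_lift_of_edges (K := ⟨1, fun _ => l⟩) fun _ => Edge.ccatForget 𝓡 hp.mpr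
  have comp_arrowEdge : φ ≫ arrowEdge 𝓡 hp = 𝟙 _ :=
    congrArg (· ≫ Edge.ccatForget 𝓡 hp.mp) (hφ (0 : Fin 1))
  refine ⟨φ, hom_ext_of_edges (p := fun _ => p) (fun _ => hp) fun j => ?_, comp_arrowEdge⟩
  obtain rfl : j = (0 : Fin 1) := Subsingleton.elim (α := Fin 1) _ _
  exact congrArg (arrowEdge 𝓡 hp ≫ ·) comp_arrowEdge

/-- The identification of the arrows of the nerve with the cofibrant objects, and of their
composition with the tensor product. -/
def tensorData : FatDelta.TensorData M (nerve 𝓡) where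
  F := CCat.functor (arrowEdge 𝓡 (l := false) (p := False) (by simp)) ⋙ Edge.toCofibrantObject 𝓡
  μ := NatIso.ofComponents
    (fun T : 𝓡.Diag (FatDelta.hops 2) =>
      T.mul (a := (0 : Fin 3)) (b := (1 : Fin 3)) (c := (2 : Fin 3)) (by decide) (by decide))
    (fun {T T' : 𝓡.Diag (FatDelta.hops 2)} f =>
      Hom.app_mul f (a := (0 : Fin 3)) (b := (1 : Fin 3)) (c := (2 : Fin 3))
        (by decide) (by decide))

lemma tensorData_mul {K : FatDelta} (T : 𝓡.Diag K) {a b c : Fin (K.edges + 1)} (hab : a < b)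
    (hbc : b < c) : (tensorData 𝓡).mul (K := K) T a b c hab hbc = (T.mul hab hbc).hom := by
  change 𝟙 _ ≫ (T.mul hab hbc).hom ≫ (𝟙 _ ⊗ₘ 𝟙 _) = _
  simp

lemma equi_links {n : ℕ} (a b : Fin (n + 1)) : (FatDelta.links n).Equi a b := fun _ _ _ => rfl

/-- The weak equivalences from the coloured arrows to the unit object. -/
def unitTrans : (FatDelta.res (nerve 𝓡)
      (FatDelta.arrow (FatDelta.links 1) (0 : Fin 2) (1 : Fin 2) (by decide)) ⋙
        (tensorData 𝓡).F) ⋙ CofibrantObject.ι ⟶ (Functor.const _).obj (𝟙_ M) where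
  app (T : 𝓡.Diag (FatDelta.links 1)) :=
    (T.edge (0 : Fin 2) (1 : Fin 2) (by decide)).unit (equi_links _ _)
  naturality (T T' : 𝓡.Diag (FatDelta.links 1)) f :=
    ((Hom.app f (0 : Fin 2) (1 : Fin 2) (by decide)).hom_unit (equi_links _ _)).trans
      (Category.comp_id _).symm

lemma weakEquivalence_unitTrans (T : (nerve 𝓡).obj (op (FatDelta.links 1))) :
    WeakEquivalence ((unitTrans 𝓡).app T) :=
  (edge (K := FatDelta.links 1) T _ _ _).weakEquivalence_unit _

/-- The nerve is the fair monoid of cofibrant objects. -/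
def cofibrantFairMonoid : CofibrantFairMonoid M (nerve 𝓡) where
  toTensorData := tensorData 𝓡
  isEquivalence := Functor.isEquivalence_trans
    (CCat.functor (arrowEdge 𝓡 _)) (Edge.toCofibrantObject 𝓡)
  equi_iff f := (CCat.equi_map_iff (arrowEdge 𝓡 _) f).symm
  associativity (T : 𝓡.Diag (FatDelta.hops 3)) :=
    (congrArg₂ (fun f g => f ≫ (_ ◁ g)) (tensorData_mul 𝓡 T _ _) (tensorData_mul 𝓡 T _ _)).trans <|
      (T.mul_associativity (a := (0 : Fin 4)) (b := (1 : Fin 4)) (c := (2 : Fin 4))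
        (d := (3 : Fin 4)) _ _ _).trans
      (congrArg₂ (fun f g => f ≫ (g ▷ _) ≫ (α_ _ _ _).hom)
        (tensorData_mul 𝓡 T _ _) (tensorData_mul 𝓡 T _ _)).symm
  ε := unitTrans 𝓡
  ε_weakEquivalence := weakEquivalence_unitTrans 𝓡
  isEquivalence_units := Functor.isEquivalence_trans
    (CCat.functor (arrowEdge 𝓡 (by simp))) (Edge.toWeakUnits 𝓡)
  equi_units := le_antisymm le_top fun T T' f _ =>
    (CCat.equi_map_iff (arrowEdge 𝓡 (l := true) (p := True) (by simp)) f).mp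
      (Edge.weakEquivalence_hom trivial _)
  unit_mul (T : 𝓡.Diag (FatDelta.links 2)) :=
    (Category.id_comp _).trans <|
      (T.mul_unit (a := (0 : Fin 3)) (b := (1 : Fin 3)) (c := (2 : Fin 3)) _ _
        (equi_links _ _)).trans
      (congrArg₂ (fun f g => f ≫ g ≫ (λ_ (𝟙_ M)).hom) (tensorData_mul 𝓡 T _ _).symm
        (congrArg₂ (· ⊗ₘ ·) (Category.id_comp _).symm (Category.id_comp _).symm))

variable {𝓡}

lemma exists_mul_hom_eq_eqToHom {K : FatDelta} (T : 𝓡.Diag K)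
    (hμ : ∀ s t, ∃ h, (𝓡.μ s t).hom = eqToHom h) {a b c : Fin (K.edges + 1)} (hab : a < b)
    (hbc : b < c) : ∃ h, (T.mul hab hbc).hom = eqToHom h :=
  𝓡.exists_mulIso_hom_eq_eqToHom hμ _

lemma isStrict_cofibrantFairMonoid (h : Function.Injective 𝓡.r)
    (hμ : ∀ s t, ∃ h, (𝓡.μ s t).hom = eqToHom h) : (cofibrantFairMonoid 𝓡).IsStrict where
  bijective := Function.Bijective.comp (g := (Edge.toCofibrantObject 𝓡).obj)
    ⟨Edge.toCofibrantObject_obj_injective h, Edge.toCofibrantObject_obj_surjective 𝓡⟩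
    (CCat.bijective_functor_obj (arrowEdge 𝓡 _))
  bijective_units := Function.Bijective.comp (g := (Edge.toWeakUnits 𝓡).obj)
    ⟨Edge.toWeakUnits_obj_injective h, Edge.toWeakUnits_obj_surjective 𝓡⟩
    (CCat.bijective_functor_obj (arrowEdge 𝓡 (by simp)))
  μ_eq T := exists_mul_hom_eq_eqToHom (K := FatDelta.hops 2) T hμ _ _

end Diag

/-! ## Strictification of the cofibrant objects -/

section

variable (x y z : CofibrantObject M) (l m n : List (CofibrantObject M))

/-- The tensor product of a non-empty list, given by its head and its tail. -/
def listTensor (x : CofibrantObject M) : List (CofibrantObject M) → M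
  | [] => x.obj
  | y :: l => x.obj ⊗ listTensor y l

/-- The tensor product of a concatenation of non-empty lists. -/
def listTensorAppend : ∀ (x : CofibrantObject M) (l : List (CofibrantObject M)),
    listTensor x (l ++ y :: m) ≅ listTensor x l ⊗ listTensor y m
  | x, [] => Iso.refl (x.obj ⊗ listTensor y m)
  | x, z :: l => whiskerLeftIso x.obj (listTensorAppend z l) ≪≫
      (α_ x.obj (listTensor z l) (listTensor y m)).symm

lemma listTensorAppend_associativity :
    (listTensorAppend z n x (l ++ y :: m)).hom ≫
        ((listTensorAppend y m x l).hom ▷ listTensor z n) ≫ (α_ _ _ _).hom =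
      eqToHom (congrArg (listTensor x) (List.append_assoc l (y :: m) (z :: n))) ≫
        (listTensorAppend y (m ++ z :: n) x l).hom ≫
        (listTensor x l ◁ (listTensorAppend z n y m).hom) := by
  induction l generalizing x with
  | nil =>
    change (x.obj ◁ (listTensorAppend z n y m).hom ≫ (α_ _ _ _).inv) ≫
      (𝟙 (x.obj ⊗ listTensor y m) ▷ _) ≫ (α_ _ _ _).hom = 𝟙 _ ≫ 𝟙 _ ≫ (x.obj ◁ _)
    simp
  | cons w l ih =>
    calc
      _ = x.obj ◁ ((listTensorAppend z n w (l ++ y :: m)).hom ≫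
            ((listTensorAppend y m w l).hom ▷ listTensor z n) ≫ (α_ _ _ _).hom) ≫
          (α_ _ _ _).inv := by
        change (x.obj ◁ _ ≫ (α_ _ _ _).inv) ≫ ((x.obj ◁ _ ≫ (α_ _ _ _).inv) ▷ _) ≫
          (α_ (x.obj ⊗ listTensor w l) _ _).hom = _
        simp
      _ = x.obj ◁ (eqToHom (congrArg (listTensor w) (List.append_assoc l (y :: m) (z :: n))) ≫
            (listTensorAppend y (m ++ z :: n) w l).hom ≫
            (listTensor w l ◁ (listTensorAppend z n y m).hom)) ≫ (α_ _ _ _).inv := by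
        rw [ih]
      _ = _ := by
        rw [MonoidalCategory.whiskerLeft_comp, whiskerLeft_eqToHom]
        change _ = eqToHom _ ≫ (x.obj ◁ _ ≫ (α_ _ _ _).inv) ≫ ((x.obj ⊗ listTensor w l) ◁ _)
        simp

lemma isCofibrant_listTensor [MonoidalModelCategory M] : IsCofibrant (listTensor x l) := by
  induction l generalizing x with
  | nil => exact x.property
  | cons y l ih =>
    have := ih y
    exact MonoidalModelCategory.isCofibrant_tensor x.obj (listTensor y l)

end

variable [MonoidalModelCategory M]

/-- The strictification by the cofibrant objects themselves, when the tensor product is strictly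
associative. -/
def ofStrictlyAssociative (h : StrictlyAssociative M) : Strictification M where
  S := ULift.{max u v} (CofibrantObject M)
  semigroup :=
    { mul := fun s t => ⟨⟨s.down.obj ⊗ t.down.obj,
        MonoidalModelCategory.isCofibrant_tensor s.down.obj t.down.obj⟩⟩
      mul_assoc := fun s t w => ULift.ext _ _ (ObjectProperty.FullSubcategory.ext
        (h s.down.obj t.down.obj w.down.obj).choose) }
  r s := s.down.obj
  isCofibrant s := s.down.property
  μ s t := Iso.refl (s.down.obj ⊗ t.down.obj)
  associativity s t w := by
    obtain ⟨h₁, h₂⟩ := h s.down.obj t.down.obj w.down.obj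
    change 𝟙 _ ≫ (𝟙 (s.down.obj ⊗ t.down.obj) ▷ w.down.obj) ≫ (α_ _ _ _).hom =
      eqToHom h₁ ≫ 𝟙 _ ≫ (s.down.obj ◁ 𝟙 (t.down.obj ⊗ w.down.obj))
    simp [h₂]
  exists_eq Z _ := ⟨⟨CofibrantObject.mk Z⟩, rfl⟩

lemma ofStrictlyAssociative_r_injective (h : StrictlyAssociative M) :
    Function.Injective (ofStrictlyAssociative h).r := fun _ _ hst =>
  ULift.ext _ _ (ObjectProperty.FullSubcategory.ext hst)

variable (M) in
/-- The strictification by the non-empty lists of cofibrant objects. -/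
def free : Strictification M where
  S := ULift.{max u v} (FreeSemigroup (CofibrantObject M))
  r s := listTensor s.down.head s.down.tail
  isCofibrant _ := isCofibrant_listTensor _ _
  μ _ _ := listTensorAppend _ _ _ _
  associativity _ _ _ := listTensorAppend_associativity _ _ _ _ _ _
  exists_eq Z _ := ⟨⟨FreeSemigroup.of (CofibrantObject.mk Z)⟩, rfl⟩

end Strictification

end

theorem mainTheorem9 {M : Type u} [Category.{v} M] [MonoidalCategory M] [ModelCategory M]
    [MonoidalModelCategory M] :
    ∃ X : FatDeltaᵒᵖ ⥤ CCat.{v, max u v}, IsFairMonoid X ∧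
      ∃ R : CofibrantFairMonoid M X, StrictlyAssociative M → R.IsStrict := by
  by_cases h : StrictlyAssociative M
  · let 𝓡 := Strictification.ofStrictlyAssociative h
    exact ⟨_, Strictification.Diag.isFairMonoid_nerve 𝓡,
      Strictification.Diag.cofibrantFairMonoid 𝓡,
      fun _ => Strictification.Diag.isStrict_cofibrantFairMonoid
        (Strictification.ofStrictlyAssociative_r_injective h) fun _ _ => ⟨rfl, rfl⟩⟩
  · let 𝓡 := Strictification.free M
    exact ⟨_, Strictification.Diag.isFairMonoid_nerve 𝓡,
      Strictification.Diag.cofibrantFairMonoid 𝓡, fun h' => absurd h' h⟩
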